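/- **Setting.** Let $d\in\mathbb N$, $|x|=\sum_{i=1}^d|x_i|$ on $\mathbb Z^d$, $\psi=\tfrac23$, $L_k=2^{k-1}$ for $k\in\mathbb Z$. For $\gamma>0$ put $\varepsilon=\gamma^{1/4}$ and $\varepsilon_k=\varepsilon^{L_k^\psi}$. Let $\Lambda\subset\mathbb Z^d$ be a rectangle, $u_x\in[-1,1]$ for $x\in\Lambda$, and let $H=H_0+V$ on $\mathbb C^{|\Lambda|}\otimes\mathbb C^2$, where $H_0=\oplus_{x\in\Lambda}h_x$ with $h_x=\begin{pmatrix}u_x&1\\1&-u_x\end{pmatrix}$, and $V$ has the $2\times2$ block $\gamma I_2$ between $x$ and $y$ if $|x-y|=1$ and $0$ otherwise. Fix $E\in\mathbb R$. Elements of $\Lambda$ are called positions; all matrix entries below are $2\times 2$ blocks labelled by pairs of positions. The following objects are defined inductively for $k\ge0$. *Blocks.* $R^{(0)}=\Lambda$. The blocks of $R^{(0)}$ are the single positions; for $k\ge1$ the blocks of $R^{(k)}$ are its components with respect to links of length at most $L_{k+1}$. *Truncated matrices.* For a real $\lambda$, $F^{(k)}_\lambda$ is given by a sum of multigraphs of level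 $k$. A multigraph of level $0$ is an entry of $H$, between equal or adjacent positions of $\Lambda$. For a block $B$ of $R^{(k)}$, let $\tilde F^{(k)}_\lambda(B)$ be the matrix, indexed by the positions of $B$ and $\{1,2\}$, which is the sum of those multigraphs of level $k$ that start and end in $B$ and all of whose positions are at distance $<L_{k-1}$ from $B$ (they are called local to $B$). Thus $\tilde F^{(0)}_\lambda(\{x\})=h_x$. *Resonance.* Every block of $R^{(0)}$ counts as isolated. For $k\ge1$ a block $B$ of $R^{(k)}$ is isolated if it has at most $L_{k+1}^{2\psi/5}$ positions, its distance from every other block of $R^{(k)}$ is at least $4L_{k+1}$, and its diameter is at most $L_{k+1}$. An isolated block is resonant if $\mathrm{dist}(\mathrm{spec}\,\tilde F^{(k)}_E(B),E)\le\varepsilon_{k+1}$. $R^{(k+1)}$ is obtained from $R^{(k)}$ by removing all blocks that are isolated but not resonant. *Next level.* Split $F^{(k)}_\lambda=\begin{pmatrix}A&B\\C&D\end{pmatrix}$ according to $R^{(k)}=R^{(k+1)}\cup(R^{(k)}\setminus R^{(k+1)})$, and write $D=W+V'$ with $W=\oplus_{B'}\tilde F^{(k)}_\lambda(B')$, the sum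 being over the removed blocks $B'$. The multigraphs of level $k+1$ are the terms of the Schur complement $F^{(k+1)}_\lambda=A-B(D-\lambda)^{-1}C$, where $(D-\lambda)^{-1}=\sum_{m\ge0}(-1)^m(W-\lambda)^{-1}[V'(W-\lambda)^{-1}]^m$ and $A,B,C,V'$ are expanded into multigraphs of level $k$; those of $V'$ are the ones that are not local to a removed block. The positions of a multigraph of level $0$ are its two ends; those of a multigraph of level $k+1$ are the positions of the multigraphs of level $k$ of which it consists, together with all positions of the blocks $B'$ in which it uses an entry of $(W-\lambda)^{-1}$. **Theorem.** For every $d$ there are constants $c_d>0$ and $\gamma_0>0$, depending only on $d$, such that for all $0<\gamma\le\gamma_0$, all rectangles $\Lambda$, all $(u_x)_{x\in\Lambda}\in[-1,1]^\Lambda$, all $E\in\mathbb R$, all $k\ge1$, and all $\lambda\in\mathbb R$ with $|\lambda-E|\le\varepsilon_k/2$, the following holds. At $\lambda$ and at $E$ the matrices $\tilde F^{(j)}(B')$, minus $\lambda$ respectively $E$, are invertible for all $j<k$ and all blocks $B'$ of $R^{(j)}$ that are removed in forming $R^{(j+1)}$, and for every block $B$ of $R^{(k)}$ the multigraph sums that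 define $\tilde F^{(k)}_\lambda(B)$ and $\tilde F^{(k)}_E(B)$ converge absolutely. Moreover, for every block $B$ of $R^{(k)}$, in operator norm, $$\|\tilde F^{(k)}_\lambda(B)-\tilde F^{(k)}_E(B)\|\le c_d\,\frac{\gamma}{\varepsilon}\,|\lambda-E|.$$ -/

import Mathlib

namespace BlockAnderson

/-- Positions: points of the lattice `ℤ^d`. -/
abbrev Pos (d : ℕ) := Fin d → ℤ

/-- The `ℓ¹` distance `|x - y| = ∑ i, |x i - y i|` on `ℤ^d`, as a real number. -/
def dist1 {d : ℕ} (x y : Pos d) : ℝ := ((∑ i, |x i - y i| : ℤ) : ℝ)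

/-- The length scales `L_k = 2^(k-1)`; in particular `L_1 = 1`, `L_0 = 1/2`. -/
noncomputable def L (k : ℤ) : ℝ := (2 : ℝ) ^ (k - 1)

/-- The exponent `ψ = 2/3`. -/
noncomputable def psi : ℝ := 2 / 3

/-- `ε = γ^φ` with `φ = 1/4`. -/
noncomputable def eps (γ : ℝ) : ℝ := γ ^ (1 / 4 : ℝ)

/-- The energy windows `ε_k = ε^(L_k^ψ)`; in particular `ε_1 = ε`. -/
noncomputable def epsk (γ : ℝ) (k : ℕ) : ℝ := eps γ ^ (L k ^ psi)

/-- The `2 × 2` block of the Hamiltonian `H = H_0 + V` between the positions `x` and `y`: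
`h_x` on the diagonal, `γ I_2` between nearest neighbours, `0` otherwise. -/
noncomputable def hamBlock {d : ℕ} (γ : ℝ) (u : Pos d → ℝ) (x y : Pos d) :
    Matrix (Fin 2) (Fin 2) ℝ :=
  open scoped Classical in
  if x = y then !![u x, 1; 1, -(u x)] else if dist1 x y = 1 then γ • 1 else 0

/-! ### Multigraphs -/

/-- A walk whose steps are elements of `G`. `direct g` is a single step (a term of the block
`A`); `through b vs c` leaves by the step `b` (a term of the block `B`), makes the
intermediate steps `vs` (terms of `V`), and returns by the step `c` (a term of the block
`C`). Between any two consecutive steps there is a jump inside a block. -/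
inductive Walk (G : Type) : Type
  | direct (g : G) : Walk G
  | through (b : G) (vs : List G) (c : G) : Walk G

namespace Walk

variable {G : Type}

def first : Walk G → G
  | direct g => g
  | through b _ _ => b

def last : Walk G → G
  | direct g => g
  | through _ _ c => c

/-- All steps, in order. -/
def steps : Walk G → List G
  | direct g => [g]
  | through b vs c => b :: (vs ++ [c])

/-- The intermediate steps, those which stand for entries of `V`. -/
def mid : Walk G → List G
  | direct _ => []
  | through _ vs _ => vs

end Walk

/-- Multigraphs of level `k`: a multigraph of level `0` is an entry `(x, y)` of `H`, and a
multigraph of level `k + 1` is a walk whose steps are multigraphs of level `k`. -/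
def Multigraph (d : ℕ) : ℕ → Type
  | 0 => Pos d × Pos d
  | k + 1 => Walk (Multigraph d k)

namespace Multigraph

variable {d : ℕ}

/-- The position where a multigraph starts. -/
def src : (k : ℕ) → Multigraph d k → Pos d
  | 0, g => Prod.fst (α := Pos d) (β := Pos d) g
  | k + 1, g => src k (Walk.first (G := Multigraph d k) g)

/-- The position where a multigraph ends. -/
def tgt : (k : ℕ) → Multigraph d k → Pos d
  | 0, g => Prod.snd (α := Pos d) (β := Pos d) g
  | k + 1, g => tgt k (Walk.last (G := Multigraph d k) g)

end Multigraph

/-- The product along a walk with steps `g₀, …, g_m`: the weights `w gᵢ` interlaced with the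
jump factors `r gᵢ gᵢ₊₁`, with the sign `(-1)^m` of the `m`-th term of
`A - B (W + V - λ)⁻¹ C = A - B (W - λ)⁻¹ C + B (W - λ)⁻¹ V (W - λ)⁻¹ C - ⋯`. -/
def chainWeight {G : Type} (r : G → G → Matrix (Fin 2) (Fin 2) ℝ)
    (w : G → Matrix (Fin 2) (Fin 2) ℝ) : List G → Matrix (Fin 2) (Fin 2) ℝ
  | [] => 1
  | [g] => w g
  | g :: g' :: l => -(w g * r g g' * chainWeight r w (g' :: l))

/-! ### The inductive procedure -/

/-- The data produced after `k` steps of the procedure. -/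
structure Stage (d k : ℕ) where
  /-- The set `R^(k)`. -/
  R : Finset (Pos d)
  /-- The multigraphs of level `k` that occur in the expansion of `F^(k)`. -/
  adm : Multigraph d k → Prop
  /-- The positions that a multigraph contains: those of all blocks it passes through. -/
  supp : Multigraph d k → Set (Pos d)
  /-- The contribution of a multigraph to `F_lam^(k)`, a `2 × 2` block between its two ends. -/
  wt : ℝ → Multigraph d k → Matrix (Fin 2) (Fin 2) ℝ

namespace Stage

variable {d k : ℕ}

/-- The block of `x ∈ R^(k)` used in step `k + 1`: the position `x` itself for `k = 0`; the
component of `x` in `R^(k)` on scale `k + 1` (spanned by links of length at most `L_{k+1}`)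
for `k ≥ 1`. -/
noncomputable def block (S : Stage d k) (x : Pos d) : Finset (Pos d) :=
  open scoped Classical in
  if k = 0 then {x} else
    S.R.filter fun y =>
      Relation.ReflTransGen (fun a b => b ∈ S.R ∧ dist1 a b ≤ L (k + 1)) x y

/-- The blocks of `R^(k)`. -/
noncomputable def blocks (S : Stage d k) : Finset (Finset (Pos d)) := S.R.image S.block

/-- A multigraph of level `k` is local to the block `B` if it starts and ends in `B` and
remains within a distance `< L_{k-1}` of `B`. (For `k = 0`, where `B` is a single position,
this leaves only the diagonal entry of `H`.) -/
def IsLocal (S : Stage d k) (B : Finset (Pos d)) (g : Multigraph d k) : Prop :=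
  g.src ∈ B ∧ g.tgt ∈ B ∧ ∀ z ∈ S.supp g, ∃ b ∈ B, dist1 z b < L (k - 1)

/-- The multigraphs from `x` to `y` that contribute to the truncation at `B`. -/
abbrev LocalGraph (S : Stage d k) (B : Finset (Pos d)) (x y : Pos d) : Type :=
  {g : Multigraph d k // S.adm g ∧ S.IsLocal B g ∧ g.src = x ∧ g.tgt = y}

/-- The truncated matrix `F̃_lam^(k)(B)`, indexed by the sites of `B`: the sum of all
multigraphs of `F_lam^(k)` that are local to `B`. -/
noncomputable def Ftilde (S : Stage d k) (lam : ℝ) (B : Finset (Pos d)) :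
    Matrix (↥B × Fin 2) (↥B × Fin 2) ℝ :=
  Matrix.of fun p q => ∑' g : S.LocalGraph B p.1 q.1, S.wt lam g.1 p.2 q.2

/-- The `2 × 2` block between `x` and `y` of the inverse of `F̃_lam^(k)(B) - lam`. -/
noncomputable def resolvent (S : Stage d k) (lam : ℝ) (B : Finset (Pos d)) (x y : Pos d) :
    Matrix (Fin 2) (Fin 2) ℝ :=
  Matrix.of fun i j =>
    if h : x ∈ B ∧ y ∈ B then
      (S.Ftilde lam B - lam • (1 : Matrix (↥B × Fin 2) (↥B × Fin 2) ℝ))⁻¹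
        (⟨x, h.1⟩, i) (⟨y, h.2⟩, j)
    else 0

/-- The block `B` of `R^(k)` is isolated on scale `k + 1`. In the first step (`k = 0`) every
position is treated as a block of its own and there is no condition. -/
def IsIsolated (S : Stage d k) (B : Finset (Pos d)) : Prop :=
  k = 0 ∨
    ((B.card : ℝ) ≤ L (k + 1) ^ (2 * psi / 5) ∧
      (∀ x ∈ B, ∀ y ∈ S.R, y ∉ B → 4 * L (k + 1) ≤ dist1 x y) ∧
      ∀ x ∈ B, ∀ y ∈ B, dist1 x y ≤ L (k + 1))

/-- The block `B` of `R^(k)` is resonant on scale `k + 1`: it is isolated and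
`dist (spec F̃_E^(k)(B), E) ≤ ε_{k+1}`. -/
def IsResonant (S : Stage d k) (γ E : ℝ) (B : Finset (Pos d)) : Prop :=
  S.IsIsolated B ∧ ∃ μ ∈ spectrum ℝ (S.Ftilde E B), |μ - E| ≤ epsk γ (k + 1)

/-- The set `R^(k+1)`: the isolated blocks that are not resonant are removed. -/
noncomputable def nextR (S : Stage d k) (γ E : ℝ) : Finset (Pos d) :=
  open scoped Classical in
  S.R.filter fun x => ¬ (S.IsIsolated (S.block x) ∧ ¬ S.IsResonant γ E (S.block x))

/-- The multigraphs of `F^(k+1) = A - B (D - lam)⁻¹ C`, where `A, B, C, D` are the blocks of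
`F^(k)` with respect to `R^(k) = R^(k+1) ∪ (R^(k) \ R^(k+1))` and
`D - lam = (W - lam) + V` is inverted by a Neumann series. The walk starts and ends in
`R^(k+1)`, its jumps take place inside blocks of `R^(k) \ R^(k+1)`, and its intermediate
steps are multigraphs of `V`, that is, not included in the block diagonal part
`W = ⊕ F̃^(k)(B)`. -/
def nextAdm (S : Stage d k) (γ E : ℝ) (w : Walk (Multigraph d k)) : Prop :=
  (∀ g ∈ w.steps, S.adm g) ∧
    w.first.src ∈ S.nextR γ E ∧ w.last.tgt ∈ S.nextR γ E ∧
    w.steps.IsChain (fun g g' =>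
      g.tgt ∈ S.R \ S.nextR γ E ∧ g'.src ∈ S.block g.tgt) ∧
    ∀ g ∈ w.mid, ¬ S.IsLocal (S.block g.src) g

/-- The positions contained in a walk: those contained in its steps and those of the blocks
in which it jumps. -/
def nextSupp (S : Stage d k) (w : Walk (Multigraph d k)) : Set (Pos d) :=
  {z | (∃ g ∈ w.steps, z ∈ S.supp g) ∨ ∃ g ∈ w.steps.dropLast, z ∈ S.block g.tgt}

/-- The weight of a walk; the jump factors are entries of `(W - lam)⁻¹`. -/
noncomputable def nextWt (S : Stage d k) (lam : ℝ) (w : Walk (Multigraph d k)) :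
    Matrix (Fin 2) (Fin 2) ℝ :=
  chainWeight (fun g g' => S.resolvent lam (S.block g.tgt) g.tgt g'.src) (S.wt lam) w.steps

/-- Step `k + 1` of the procedure. -/
noncomputable def next (S : Stage d k) (γ E : ℝ) : Stage d (k + 1) where
  R := S.nextR γ E
  adm := S.nextAdm γ E
  supp := S.nextSupp
  wt := S.nextWt

end Stage

/-- The start of the procedure: `R^(0) = Λ` and `F^(0) = H`, whose multigraphs are the entries
of `H` at equal or nearest neighbour positions of `Λ`. -/
noncomputable def stageZero {d : ℕ} (γ : ℝ) (Λ : Finset (Pos d)) (u : Pos d → ℝ) :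
    Stage d 0 where
  R := Λ
  adm := fun g : Pos d × Pos d => g.1 ∈ Λ ∧ g.2 ∈ Λ ∧ (g.1 = g.2 ∨ dist1 g.1 g.2 = 1)
  supp := fun g : Pos d × Pos d => {g.1, g.2}
  wt := fun _ (g : Pos d × Pos d) => hamBlock γ u g.1 g.2

/-- The result of `k` steps of the procedure at the fixed energy `E`. -/
noncomputable def stage {d : ℕ} (γ : ℝ) (Λ : Finset (Pos d)) (u : Pos d → ℝ) (E : ℝ) :
    (k : ℕ) → Stage d k
  | 0 => stageZero γ Λ u
  | k + 1 => (stage γ Λ u E k).next γ E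

end BlockAnderson

namespace BlockAnderson

/-! ### The length potential -/

/-! Every multigraph `g` carries a budget `b` and a factor `X` such that its weight is at most `X *
γ ^ b`. A hop `γ` is split into `γ^(1/4)`, which makes sums over multigraphs small, and `γ^(3/4)`,
which enters the budget. The budget always has the form `pot D`, where `D` bounds the length of the
way from the source through any contained position to the target.

A jump in a removed block at scale `l = L (k + 1)` involves a resolvent of order `γ^(-l^ψ/4)`.
Concavity of `pot` pays for it: removed blocks are separated by `4 * l` from the rest and non-local
steps have extent at least `l / 2`, so joining two pieces of a walk at a block leaves `7/25 * l^ψ`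
to spare (`pot_far_far`, `pot_loop_far`; at level 0, where blocks are single positions,
`pot_one_one`). Hence budgets keep the form `pot D` (`Regular.next`). The excess of `7/25` over
`1/4` gives each jump a small factor that beats the number of positions in a block, so the factors
of all multigraphs from one position sum to at most 4 at every level (`stage_factorSum_le`).

Changing the energy in one resolvent costs a second `γ^(-l^ψ/4)`. A walk that jumps at this scale
has budget at least `3/4 * l^ψ`, so two thirds of its budget survive. It also has extent at least 2,
hence budget at least `9/8`, and the surviving power is at most `γ^(3/4) = γ/ε`. Multigraphs without
jumps do not depend on the energy. Reversal of multigraphs makes the truncated matrices symmetric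
(`stage_reversible`), and the Schur test yields the Lipschitz constant `4γ/ε`
(`Bounded.norm_Ftilde_sub_le`); only `γ₀` depends on `d`.

The induction closes because this constant is small: non-resonance at `E` then bounds the shifted
truncated matrix at `lam` from below (`Bounded.mul_norm_le`), which gives the resolvent bounds for
the next level (`Bounded.next`). -/

/-- The potential `f(D) = (3/4) D^{2/3}` that measures the decay of a multigraph of extent `D`. -/
noncomputable def pot (D : ℝ) : ℝ := 3 / 4 * D ^ psi

theorem psi_pos : 0 < psi := by norm_num [psi]

/-- Since `psi = 2/3`, cubing turns decimal bounds on powers into rational arithmetic; likewise in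
`le_rpow_psi`. -/
theorem rpow_psi_le {a b : ℝ} (ha : 0 ≤ a) (hb : 0 ≤ b) (h : a ^ 2 ≤ b ^ 3) : a ^ psi ≤ b := by
  have h1 : (a ^ psi) ^ 3 ≤ b ^ 3 := by
    rw [← Real.rpow_natCast, ← Real.rpow_mul ha]
    have : psi * ((3 : ℕ) : ℝ) = ((2 : ℕ) : ℝ) := by norm_num [psi]
    rw [this, Real.rpow_natCast]
    exact h
  exact le_of_pow_le_pow_left₀ (by norm_num) hb h1

theorem le_rpow_psi {a b : ℝ} (ha : 0 ≤ a) (h : b ^ 3 ≤ a ^ 2) : b ≤ a ^ psi := by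
  have h1 : b ^ 3 ≤ (a ^ psi) ^ 3 := by
    rw [← Real.rpow_natCast (a ^ psi), ← Real.rpow_mul ha]
    have : psi * ((3 : ℕ) : ℝ) = ((2 : ℕ) : ℝ) := by norm_num [psi]
    rw [this, Real.rpow_natCast]
    exact h
  exact le_of_pow_le_pow_left₀ (by norm_num) (Real.rpow_nonneg ha _) h1

theorem pot_nonneg {D : ℝ} (h : 0 ≤ D) : 0 ≤ pot D := by unfold pot; positivity

theorem pot_zero : pot 0 = 0 := by
  unfold pot; rw [Real.zero_rpow psi_pos.ne']; simp

theorem pot_mono {a b : ℝ} (ha : 0 ≤ a) (h : a ≤ b) : pot a ≤ pot b := by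
  unfold pot
  have := Real.rpow_le_rpow ha h psi_pos.le
  linarith

theorem le_of_pot_le {a b : ℝ} (hb : 0 ≤ b) (h : pot a ≤ pot b) : a ≤ b := by
  by_contra! hlt
  have := Real.rpow_lt_rpow hb hlt psi_pos
  unfold pot at h
  linarith

theorem exists_pot_eq {s : ℝ} (hs : 0 ≤ s) : ∃ D, 0 ≤ D ∧ pot D = s := by
  refine ⟨(4 / 3 * s) ^ psi⁻¹, by positivity, ?_⟩
  unfold pot
  rw [← Real.rpow_mul (by positivity), inv_mul_cancel₀ psi_pos.ne', Real.rpow_one]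
  ring

/-- The increments of a concave power decrease. -/
theorem pot_add_sub_le {a b s : ℝ} (ha : 0 ≤ a) (hab : a ≤ b) (hs : 0 ≤ s) :
    pot (b + s) - pot b ≤ pot (a + s) - pot a := by
  have hc : ConcaveOn ℝ (Set.Ici 0) fun x : ℝ => x ^ psi :=
    Real.concaveOn_rpow psi_pos.le (by norm_num [psi])
  rcases eq_or_lt_of_le hab with rfl | hlt
  · rfl
  rcases eq_or_lt_of_le hs with rfl | hs'
  · simp
  have hd : 0 < b + s - a := by linarith
  have hd' := hd.ne'
  have ma : a ∈ Set.Ici (0 : ℝ) := ha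
  have mb : b + s ∈ Set.Ici (0 : ℝ) := by simp only [Set.mem_Ici]; linarith
  have p1 : 0 ≤ s / (b + s - a) := by positivity
  have p2 : 0 ≤ (b - a) / (b + s - a) := div_nonneg (by linarith) hd.le
  -- The inner points `b` and `a + s` are convex combinations of `a` and `b + s` with interchanged
  -- weights; the sum of the two concavity inequalities is the claim.
  have h1 := hc.2 ma mb p1 p2 (by field_simp; ring)
  have h2 := hc.2 ma mb p2 p1 (by field_simp; ring)
  simp only [smul_eq_mul] at h1 h2
  have e1 : s / (b + s - a) * a + (b - a) / (b + s - a) * (b + s) = b := by field_simp; ring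
  have e2 : (b - a) / (b + s - a) * a + s / (b + s - a) * (b + s) = a + s := by
    field_simp; ring
  rw [e1] at h1
  rw [e2] at h2
  have e3 : s / (b + s - a) = 1 - (b - a) / (b + s - a) := by field_simp; ring
  rw [e3] at h1 h2
  unfold pot
  nlinarith

theorem pot_scale {a l : ℝ} (ha : 0 ≤ a) (hl : 0 ≤ l) : pot (a * l) = pot a * l ^ psi := by
  unfold pot; rw [Real.mul_rpow ha hl]; ring

/-- By concavity the gain from splitting grows with both parts, so it need only be checked at the
smallest admissible lengths; there homogeneity reduces it to numbers. -/
theorem pot_add_pot_ge {a b D t s : ℝ} (ha : 0 ≤ a) (hb : 0 ≤ b) (hD : a ≤ D) (ht : b ≤ t)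
    (hs : 0 ≤ s) : pot a + pot b - pot (a + b + s) ≤ pot D + pot t - pot (D + t + s) := by
  have h1 := pot_add_sub_le ha hD (s := b + s) (by positivity)
  have h2 := pot_add_sub_le hb ht (s := D + s) (by linarith)
  rw [show a + b + s = a + (b + s) by ring]
  rw [show D + (b + s) = b + (D + s) by ring] at h1
  rw [show D + t + s = t + (D + s) by ring]
  linarith

/-! ### Numerical gains that pay for a jump -/

/-- For a move between distinct blocks: both parts span the separation `4 * l`, and `2 * l` allows
for detours inside blocks of diameter `l`. The constant `7/25` lies between the resolvent exponent
`1/4` and the gain `3/4 * (2 * 4^ψ - 10^ψ)`, about `0.297`. -/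
theorem pot_far_far {l D t : ℝ} (hl : 0 ≤ l) (hD : 4 * l ≤ D) (ht : 4 * l ≤ t) :
    pot (D + t + 2 * l) + 7 / 25 * l ^ psi ≤ pot D + pot t := by
  have h := pot_add_pot_ge (by positivity) (by positivity) hD ht (s := 2 * l) (by positivity)
  rw [show 4 * l + 4 * l + 2 * l = 10 * l by ring, pot_scale (by norm_num) hl,
    pot_scale (by norm_num) hl] at h
  have h4 : (2.519 : ℝ) ≤ 4 ^ psi := le_rpow_psi (by norm_num) (by norm_num)
  have h10 : (10 : ℝ) ^ psi ≤ 4.642 := rpow_psi_le (by norm_num) (by norm_num) (by norm_num)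
  have hl' : 0 ≤ l ^ psi := by positivity
  unfold pot at h ⊢
  nlinarith

/-- For a non-local step that returns to its own block: its extent is only known to be `l / 2`, but
no detour between blocks has to be paid. -/
theorem pot_loop_far {l D t : ℝ} (hl : 0 ≤ l) (hD : l / 2 ≤ D) (ht : 4 * l ≤ t) :
    pot (D + t) + 7 / 25 * l ^ psi ≤ pot D + pot t := by
  have h := pot_add_pot_ge (a := 1 / 2 * l) (D := D) (by positivity) (by positivity) (by linarith) ht
    (s := 0) (le_refl _)
  rw [show 1 / 2 * l + 4 * l + 0 = 4.5 * l by ring, pot_scale (by norm_num) hl,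
    pot_scale (by norm_num) hl, pot_scale (by norm_num) hl, add_zero] at h
  have h4 : (2.519 : ℝ) ≤ 4 ^ psi := le_rpow_psi (by norm_num) (by norm_num)
  have h1 : (0.6299 : ℝ) ≤ (1 / 2) ^ psi := le_rpow_psi (by norm_num) (by norm_num)
  have h10 : (4.5 : ℝ) ^ psi ≤ 2.726 := rpow_psi_le (by norm_num) (by norm_num) (by norm_num)
  have hl' : 0 ≤ l ^ psi := by positivity
  unfold pot at h ⊢
  nlinarith

theorem le_pot_loop {l D : ℝ} (hl : 0 ≤ l) (hD : l / 2 ≤ D) : 7 / 25 * l ^ psi ≤ pot D := by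
  have h := pot_mono (a := 1 / 2 * l) (by positivity) (by linarith : 1 / 2 * l ≤ D)
  rw [pot_scale (by norm_num) hl] at h
  have h1 : (0.6299 : ℝ) ≤ (1 / 2) ^ psi := le_rpow_psi (by norm_num) (by norm_num)
  have hl' : 0 ≤ l ^ psi := by positivity
  unfold pot at h ⊢
  nlinarith

theorem pot_one_one {D t : ℝ} (hD : 1 ≤ D) (ht : 1 ≤ t) :
    pot (D + t) + 7 / 25 ≤ pot D + pot t := by
  have h := pot_add_pot_ge (by norm_num) (by norm_num) hD ht (s := 0) (le_refl _)
  have h10 : (1 + 1 + 0 : ℝ) ^ psi ≤ 1.5875 :=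
    rpow_psi_le (by norm_num) (by norm_num) (by norm_num)
  have h1 : (1 : ℝ) ^ psi = 1 := Real.one_rpow _
  rw [add_zero (D + t)] at h
  unfold pot at h ⊢
  rw [h1] at h
  nlinarith

theorem pot_one : pot 1 = 3 / 4 := by simp [pot]

/-- The value `9/8` is what the Lipschitz bound needs: two thirds of it is the exponent `3/4` of
`γ/ε`. -/
theorem le_pot_two : 9 / 8 ≤ pot 2 := by
  have h1 : (1.58 : ℝ) ≤ 2 ^ psi := le_rpow_psi (by norm_num) (by norm_num)
  unfold pot; linarith

theorem le_pot_of_le {l D : ℝ} (hl : 0 ≤ l) (h : l ≤ D) : 3 / 4 * l ^ psi ≤ pot D := by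
  unfold pot
  have := Real.rpow_le_rpow hl h psi_pos.le
  linarith

/-! ### The length scales -/

theorem L_succ (j : ℕ) : L ((j : ℤ) + 1) = 2 ^ j := by
  unfold L; simp

theorem L_pos (k : ℤ) : 0 < L k := by unfold L; positivity

/-- A non-local multigraph goes out to distance `L (k - 1)` from its block and comes back; the
identity expresses that length in the scale of the jump. -/
theorem L_pred (j : ℤ) : 2 * L (j - 1) = L (j + 1) / 2 := by
  unfold L
  rw [show j + 1 - 1 = (j - 1 - 1) + 2 by ring, zpow_add₀ (by norm_num)]
  norm_num; ring

/-- The exponent `L_{j+1}^ψ`. -/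
noncomputable def scaleExp (j : ℕ) : ℝ := L ((j : ℤ) + 1) ^ psi

/-- Bernoulli's inequality for `(2^ψ)^j`. Linear growth suffices, because the powers of `γ` only
have to beat geometric sequences in `j`. -/
theorem one_add_half_le_scaleExp (j : ℕ) : 1 + (j : ℝ) / 2 ≤ scaleExp j := by
  unfold scaleExp
  rw [L_succ, ← Real.rpow_natCast, ← Real.rpow_mul (by norm_num), mul_comm,
    Real.rpow_mul (by norm_num), Real.rpow_natCast]
  have h1 : (1.5 : ℝ) ≤ 2 ^ psi := le_rpow_psi (by norm_num) (by norm_num)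
  calc 1 + (j : ℝ) / 2 = 1 + (j : ℝ) * (1 / 2) := by ring
    _ ≤ (1 + 1 / 2 : ℝ) ^ j := one_add_mul_le_pow (by norm_num) j
    _ ≤ _ := by gcongr; norm_num at h1 ⊢; exact h1

theorem scaleExp_pos (j : ℕ) : 0 < scaleExp j := by
  have := one_add_half_le_scaleExp j
  have : (0 : ℝ) ≤ j := Nat.cast_nonneg j
  linarith

theorem scaleExp_mono {i j : ℕ} (h : i ≤ j) : scaleExp i ≤ scaleExp j := by
  unfold scaleExp
  rw [L_succ, L_succ]
  exact Real.rpow_le_rpow (by positivity) (pow_le_pow_right₀ (by norm_num) h) psi_pos.le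

theorem epsk_succ {γ : ℝ} (hγ : 0 < γ) (j : ℕ) : epsk γ (j + 1) = γ ^ (scaleExp j / 4) := by
  unfold epsk eps scaleExp
  rw [← Real.rpow_mul hγ.le]
  push_cast
  ring_nf

/-- The factor that a jump at level `j` contributes after the budget is split off. -/
noncomputable def jumpFactor (γ : ℝ) (j : ℕ) : ℝ := 144 * γ ^ (3 / 100 * scaleExp j)

theorem jumpFactor_nonneg {γ : ℝ} (hγ : 0 ≤ γ) (j : ℕ) : 0 ≤ jumpFactor γ j := by
  unfold jumpFactor; positivity

theorem jumpFactor_mul_le {γ : ℝ} (hγ : 0 < γ) (h : γ ^ (3 / 100 : ℝ) ≤ 2⁻¹ ^ 14) (j : ℕ) :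
    jumpFactor γ j * 2 ^ j ≤ (1 / 2) ^ (j + 6) := by
  -- One factor `2⁻¹ ^ 14` absorbs the constant 144; the growth of `scaleExp j` supplies `4^(-j)`
  -- against the block size `2^j`.
  have h1 : γ ^ (3 / 100 * scaleExp j) ≤ 2⁻¹ ^ 14 * (2⁻¹ ^ 2) ^ j := by
    rw [Real.rpow_mul hγ.le]
    calc (γ ^ (3 / 100 : ℝ)) ^ scaleExp j ≤ ((2⁻¹ : ℝ) ^ 14) ^ scaleExp j :=
          Real.rpow_le_rpow (by positivity) h (scaleExp_pos j).le
      _ ≤ ((2⁻¹ : ℝ) ^ 14) ^ (1 + (j : ℝ) / 2) :=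
          Real.rpow_le_rpow_of_exponent_ge (by positivity) (by norm_num)
            (one_add_half_le_scaleExp j)
      _ = 2⁻¹ ^ 14 * ((2⁻¹ : ℝ) ^ 14) ^ ((j : ℝ) / 2) := by
          rw [Real.rpow_add (by positivity), Real.rpow_one]
      _ ≤ _ := by
          gcongr
          rw [← Real.rpow_natCast ((2⁻¹ : ℝ) ^ 2), ← Real.rpow_natCast (2⁻¹ : ℝ),
            ← Real.rpow_natCast (2⁻¹ : ℝ), ← Real.rpow_mul (by norm_num),
            ← Real.rpow_mul (by norm_num)]
          apply Real.rpow_le_rpow_of_exponent_ge (by norm_num) (by norm_num)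
          have : (0 : ℝ) ≤ j := Nat.cast_nonneg j
          push_cast
          linarith
  unfold jumpFactor
  calc 144 * γ ^ (3 / 100 * scaleExp j) * 2 ^ j
      ≤ 144 * (2⁻¹ ^ 14 * (2⁻¹ ^ 2) ^ j) * 2 ^ j := by gcongr
    _ = 144 * 2⁻¹ ^ 14 * ((2⁻¹ ^ 2) * 2) ^ j := by rw [mul_pow]; ring
    _ = 144 * 2⁻¹ ^ 14 * (1 / 2) ^ j := by norm_num
    _ ≤ (1 / 2) ^ 6 * (1 / 2) ^ j := by gcongr; norm_num
    _ = _ := by rw [← pow_add, add_comm]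

/-! ### The distance on the lattice -/

section Dist

variable {d : ℕ}

theorem dist1_comm (x y : Pos d) : dist1 x y = dist1 y x := by
  unfold dist1; simp only [abs_sub_comm]

theorem dist1_self (x : Pos d) : dist1 x x = 0 := by simp [dist1]

theorem dist1_nonneg (x y : Pos d) : 0 ≤ dist1 x y := by
  unfold dist1
  exact_mod_cast Finset.sum_nonneg fun i _ => abs_nonneg _

theorem dist1_triangle (x y z : Pos d) : dist1 x z ≤ dist1 x y + dist1 y z := by
  unfold dist1
  rw [← Int.cast_add, ← Finset.sum_add_distrib]
  exact_mod_cast Finset.sum_le_sum fun i _ => abs_sub_le _ _ _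

theorem one_le_dist1 {x y : Pos d} (h : x ≠ y) : 1 ≤ dist1 x y := by
  unfold dist1
  obtain ⟨i, hi⟩ := Function.ne_iff.1 h
  have h1 : 1 ≤ |x i - y i| := Int.one_le_abs (sub_ne_zero.2 hi)
  have h2 : |x i - y i| ≤ ∑ i, |x i - y i| :=
    Finset.single_le_sum (f := fun i => |x i - y i|) (fun i _ => abs_nonneg _)
      (Finset.mem_univ i)
  exact_mod_cast h1.trans h2

end Dist

/-! ### Blocks -/

namespace Stage

variable {d k : ℕ} (S : Stage d k)

theorem block_zero (S : Stage d 0) (x : Pos d) : S.block x = {x} := by simp [block]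

theorem mem_block_iff (hk : k ≠ 0) {x y : Pos d} : y ∈ S.block x ↔ y ∈ S.R ∧
    Relation.ReflTransGen (fun a b => b ∈ S.R ∧ dist1 a b ≤ L (k + 1)) x y := by
  simp [block, hk]

theorem mem_block_self {x : Pos d} (hx : x ∈ S.R) : x ∈ S.block x := by
  by_cases hk : k = 0
  · simp [block, hk]
  · exact (S.mem_block_iff hk).2 ⟨hx, .refl⟩

theorem mem_R_of_mem_block {x y : Pos d} (hx : x ∈ S.R) (hy : y ∈ S.block x) : y ∈ S.R := by
  by_cases hk : k = 0
  · simp only [block, hk, if_true, Finset.mem_singleton] at hy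
    exact hy ▸ hx
  · exact ((S.mem_block_iff hk).1 hy).1

theorem mem_block_symm {x y : Pos d} (hx : x ∈ S.R) (hy : y ∈ S.block x) : x ∈ S.block y := by
  by_cases hk : k = 0
  · simp only [block, hk, if_true, Finset.mem_singleton] at hy ⊢
    exact hy.symm
  · rw [S.mem_block_iff hk] at hy ⊢
    refine ⟨hx, ?_⟩
    suffices h : ∀ z, Relation.ReflTransGen
        (fun a b => b ∈ S.R ∧ dist1 a b ≤ L (k + 1)) x z → z ∈ S.R ∧ Relation.ReflTransGen
        (fun a b => b ∈ S.R ∧ dist1 a b ≤ L (k + 1)) z x from (h y hy.2).2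
    intro z hz
    induction hz with
    | refl => exact ⟨hx, .refl⟩
    | tail _ h ih => exact ⟨h.1, .head ⟨ih.1, by rw [dist1_comm]; exact h.2⟩ ih.2⟩

theorem block_subset_of_mem {x y : Pos d} (hy : y ∈ S.block x) : S.block y ⊆ S.block x := by
  intro z hz
  by_cases hk : k = 0
  · simp only [block, hk, if_true, Finset.mem_singleton] at hy hz ⊢
    exact hz.trans hy
  · rw [S.mem_block_iff hk] at *
    exact ⟨hz.1, hy.2.trans hz.2⟩

theorem block_eq_of_mem {x y : Pos d} (hx : x ∈ S.R) (hy : y ∈ S.block x) :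
    S.block y = S.block x :=
  (S.block_subset_of_mem hy).antisymm (S.block_subset_of_mem (S.mem_block_symm hx hy))

variable {S} {γ E : ℝ}

theorem mem_nextR_iff {x : Pos d} : x ∈ S.nextR γ E ↔ x ∈ S.R ∧
    ¬ (S.IsIsolated (S.block x) ∧ ¬ S.IsResonant γ E (S.block x)) := by
  simp [nextR]

theorem mem_sdiff_nextR_iff {x : Pos d} : x ∈ S.R \ S.nextR γ E ↔ x ∈ S.R ∧
    S.IsIsolated (S.block x) ∧ ¬ S.IsResonant γ E (S.block x) := by
  rw [Finset.mem_sdiff, mem_nextR_iff]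
  exact ⟨fun h => ⟨h.1, not_not.1 fun h' => h.2 ⟨h.1, h'⟩⟩, fun h => ⟨h.1, fun h' => h'.2 h.2⟩⟩

theorem mem_sdiff_nextR_of_mem_block {x y : Pos d} (hx : x ∈ S.R \ S.nextR γ E)
    (hy : y ∈ S.block x) : y ∈ S.R \ S.nextR γ E := by
  rw [mem_sdiff_nextR_iff] at *
  rw [S.block_eq_of_mem hx.1 hy]
  exact ⟨S.mem_R_of_mem_block hx.1 hy, hx.2⟩

theorem not_mem_block_of_mem_nextR {x y : Pos d} (hx : x ∈ S.R \ S.nextR γ E)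
    (hy : y ∈ S.nextR γ E) : y ∉ S.block x := fun h =>
  (Finset.mem_sdiff.1 (mem_sdiff_nextR_of_mem_block hx h)).2 hy

theorem far_of_not_mem_block (hk : k ≠ 0) {x y a : Pos d} (hx : x ∈ S.R \ S.nextR γ E)
    (hy : y ∈ S.R) (h : y ∉ S.block x) (ha : a ∈ S.block x) :
    4 * L (k + 1) ≤ dist1 a y :=
  (((mem_sdiff_nextR_iff.1 hx).2.1).resolve_left hk).2.1 a ha y hy h

theorem diam_block (hk : k ≠ 0) {x a b : Pos d} (hx : x ∈ S.R \ S.nextR γ E)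
    (ha : a ∈ S.block x) (hb : b ∈ S.block x) : dist1 a b ≤ L (k + 1) :=
  (((mem_sdiff_nextR_iff.1 hx).2.1).resolve_left hk).2.2 a ha b hb

/-- The exponent `2 * psi / 5 = 4/15` is weakened to 1: the jump factor beats even the full scale `2
^ k`. -/
theorem card_block_le {x : Pos d} (hx : x ∈ S.R \ S.nextR γ E) :
    (S.block x).card ≤ 2 ^ k := by
  rcases (mem_sdiff_nextR_iff.1 hx).2.1 with hk | h
  · subst hk
    simp [block]
  · have h2 : ((S.block x).card : ℝ) ≤ 2 ^ k := by
      refine h.1.trans ?_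
      rw [L_succ]
      calc ((2 : ℝ) ^ k) ^ (2 * psi / 5) ≤ ((2 : ℝ) ^ k) ^ (1 : ℝ) :=
            Real.rpow_le_rpow_of_exponent_le (one_le_pow₀ (by norm_num)) (by norm_num [psi])
        _ = _ := Real.rpow_one _
    exact_mod_cast h2

end Stage

/-! ### Budgets and factors of multigraphs -/

/-- The budget of a list of steps: the budgets of the steps, less `κ` for each jump. -/
noncomputable def listBudget {G : Type} (κ : ℝ) (S : G → ℝ) : List G → ℝ
  | [] => 0
  | [g] => S g
  | g :: g' :: l => S g - κ + listBudget κ S (g' :: l)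

/-- The factor of a list of steps: the product of the factors of the steps, and `η` for each
jump. -/
noncomputable def listFactor {G : Type} (η : ℝ) (X : G → ℝ) : List G → ℝ
  | [] => 1
  | [g] => X g
  | g :: g' :: l => X g * η * listFactor η X (g' :: l)

/-- The cost of a jump at level `k`, as a power of `γ⁻¹`. -/
noncomputable def jumpCost (k : ℕ) : ℝ := 7 / 25 * scaleExp k

namespace Multigraph

variable {d : ℕ}

/-- The budget of a multigraph `g`: its weight is at most `factor g * γ ^ budget g`. -/
noncomputable def budget : (k : ℕ) → Multigraph d k → ℝ
  | 0, g => open scoped Classical in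
      if Prod.fst (α := Pos d) (β := Pos d) g = Prod.snd (α := Pos d) (β := Pos d) g
        then 0 else 3 / 4
  | k + 1, g =>
      listBudget (jumpCost k) (budget k) (Walk.steps (G := Multigraph d k) g)

/-- The factor of a multigraph: its weight is at most `factor g * γ ^ budget g`. -/
noncomputable def factor (γ : ℝ) : (k : ℕ) → Multigraph d k → ℝ
  | 0, g => open scoped Classical in
      if Prod.fst (α := Pos d) (β := Pos d) g = Prod.snd (α := Pos d) (β := Pos d) g
        then 3 else γ ^ (1 / 4 : ℝ)
  | k + 1, g =>
      listFactor (jumpFactor γ k) (factor γ k) (Walk.steps (G := Multigraph d k) g)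

end Multigraph

theorem listFactor_nonneg {G : Type} {η : ℝ} {X : G → ℝ} (hη : 0 ≤ η) (hX : ∀ g, 0 ≤ X g) :
    ∀ l, 0 ≤ listFactor η X l
  | [] => zero_le_one
  | [g] => hX g
  | g :: g' :: l => mul_nonneg (mul_nonneg (hX g) hη) (listFactor_nonneg hη hX (g' :: l))

theorem Multigraph.factor_nonneg {d : ℕ} {γ : ℝ} (hγ : 0 ≤ γ) :
    ∀ (k : ℕ) (g : Multigraph d k), 0 ≤ factor γ k g
  | 0, g => by unfold factor; split_ifs <;> positivity
  | k + 1, g => listFactor_nonneg (jumpFactor_nonneg hγ k) (factor_nonneg hγ k) _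

/-! ### Extents -/

namespace Stage

variable {d k : ℕ}

/-- The facts about the multigraphs of a stage that are independent of the energy: ends and
supports, and the bound of the extent of a multigraph by its budget. -/
structure Regular (S : Stage d k) : Prop where
  src_mem : ∀ g, S.adm g → g.src ∈ S.R
  tgt_mem : ∀ g, S.adm g → g.tgt ∈ S.R
  src_supp : ∀ g, S.adm g → g.src ∈ S.supp g
  tgt_supp : ∀ g, S.adm g → g.tgt ∈ S.supp g
  extent : ∀ g, S.adm g → ∃ D, 0 ≤ D ∧ pot D = g.budget k ∧
    ∀ z ∈ S.supp g, dist1 g.src z + dist1 z g.tgt ≤ D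

/-- The positions contained in a list of steps. -/
def listSupp (S : Stage d k) (l : List (Multigraph d k)) : Set (Pos d) :=
  {z | (∃ g ∈ l, z ∈ S.supp g) ∨ ∃ g ∈ l.dropLast, z ∈ S.block g.tgt}

theorem mem_listSupp_cons_cons {S : Stage d k} {g g' : Multigraph d k}
    {l : List (Multigraph d k)} {z : Pos d} : z ∈ S.listSupp (g :: g' :: l) ↔
      z ∈ S.supp g ∨ z ∈ S.block g.tgt ∨ z ∈ S.listSupp (g' :: l) := by
  simp only [listSupp, Set.mem_ofPred_eq, List.mem_cons, List.dropLast_cons_cons,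
    exists_eq_or_imp]
  grind

theorem mem_listSupp_singleton {S : Stage d k} {g : Multigraph d k} {z : Pos d} :
    z ∈ S.listSupp [g] ↔ z ∈ S.supp g := by
  simp [listSupp]

variable {S : Stage d k} {γ E : ℝ}

theorem Regular.dist_src_tgt_le (hS : S.Regular) {g : Multigraph d k} (hg : S.adm g) {D : ℝ}
    (hD : ∀ z ∈ S.supp g, dist1 g.src z + dist1 z g.tgt ≤ D) : dist1 g.src g.tgt ≤ D := by
  have := hD _ (hS.src_supp g hg)
  rwa [dist1_self, zero_add] at this

/-- A multigraph that is not local to the block where it starts has a large extent. -/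
theorem Regular.extent_of_not_isLocal (hS : S.Regular) (hk : k ≠ 0) {g : Multigraph d k}
    (hg : S.adm g) (hsrc : g.src ∈ S.R \ S.nextR γ E)
    (hl : ¬ S.IsLocal (S.block g.src) g) {D : ℝ}
    (hD : ∀ z ∈ S.supp g, dist1 g.src z + dist1 z g.tgt ≤ D) : L (k + 1) / 2 ≤ D := by
  have hself := S.mem_block_self (hS.src_mem g hg)
  by_cases ht : g.tgt ∈ S.block g.src
  · simp only [IsLocal, hself, ht, true_and] at hl
    push Not at hl
    obtain ⟨z, hz, hzb⟩ := hl
    have h1 := hzb _ hself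
    have h2 := hzb _ ht
    have h3 := hD z hz
    rw [dist1_comm] at h1
    have := L_pred (k : ℤ)
    linarith
  · have h1 := far_of_not_mem_block hk hsrc (hS.tgt_mem g hg) ht hself
    have h2 := hS.dist_src_tgt_le hg hD
    have := L_pos (k + 1 : ℤ)
    linarith

/-- The relation between consecutive steps of a walk. -/
def Linked (S : Stage d k) (γ E : ℝ) (g g' : Multigraph d k) : Prop :=
  g.tgt ∈ S.R \ S.nextR γ E ∧ g'.src ∈ S.block g.tgt

/-- The extent of the remainder of a walk, seen from the removed block where it starts. -/
theorem Regular.extent_remainder (hS : S.Regular) (hk : k ≠ 0) :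
    ∀ (l : List (Multigraph d k)) (g : Multigraph d k), (∀ h ∈ g :: l, S.adm h) →
      (g :: l).IsChain (S.Linked γ E) → g.src ∈ S.R \ S.nextR γ E →
      ((g :: l).getLast (by simp)).tgt ∈ S.nextR γ E →
      (∀ h ∈ (g :: l).dropLast, ¬ S.IsLocal (S.block h.src) h) →
      ∃ t, 4 * L (k + 1) ≤ t ∧
        pot t = listBudget (jumpCost k) (Multigraph.budget k) (g :: l) ∧
        (∀ a ∈ S.block g.src,
          dist1 a ((g :: l).getLast (by simp)).tgt ≤ t + L (k + 1)) ∧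
        ∀ z, z ∈ S.block g.src ∨ z ∈ S.listSupp (g :: l) → ∀ a ∈ S.block g.src,
          dist1 a z + dist1 z ((g :: l).getLast (by simp)).tgt ≤ t + 2 * L (k + 1)
  | [], g, hadm, _, hsrc, htgt, _ => by
    have hg := hadm g (by simp)
    obtain ⟨D, hD0, hDp, hD⟩ := hS.extent g hg
    have hself := S.mem_block_self (hS.src_mem g hg)
    have hDd := hS.dist_src_tgt_le hg hD
    simp only [List.getLast_singleton] at htgt ⊢
    have hL := L_pos (k + 1 : ℤ)
    have hfar := far_of_not_mem_block hk hsrc (hS.tgt_mem g hg)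
      (not_mem_block_of_mem_nextR hsrc htgt) hself
    have hdist : ∀ a ∈ S.block g.src, dist1 a g.tgt ≤ D + L (k + 1) := fun a ha => by
      have := dist1_triangle a g.src g.tgt
      have := diam_block hk hsrc ha hself
      linarith
    refine ⟨D, by linarith, hDp, hdist, ?_⟩
    rintro z (hz | hz) a ha
    · have := hdist z hz
      have := diam_block hk hsrc ha hz
      linarith
    · rw [mem_listSupp_singleton] at hz
      have := hD z hz
      have := dist1_triangle a g.src z
      have := diam_block hk hsrc ha hself
      linarith
  | g' :: l, g, hadm, hch, hsrc, htgt, hmid => by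
    have hg := hadm g (by simp)
    obtain ⟨D, hD0, hDp, hD⟩ := hS.extent g hg
    have hself := S.mem_block_self (hS.src_mem g hg)
    have hDd := hS.dist_src_tgt_le hg hD
    rw [List.isChain_cons_cons] at hch
    have hsrc' := mem_sdiff_nextR_of_mem_block hch.1.1 hch.1.2
    have hbl : S.block g'.src = S.block g.tgt :=
      S.block_eq_of_mem (hS.tgt_mem g hg) hch.1.2
    simp only [List.getLast_cons_cons] at htgt ⊢
    obtain ⟨t', ht', htp, htd, htz⟩ := hS.extent_remainder hk l g'
      (fun h hh => hadm h (List.mem_cons_of_mem _ hh)) hch.2 hsrc' htgt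
      (fun h hh => hmid h (by simp only [List.dropLast_cons_cons]; exact .tail _ hh))
    set y := ((g' :: l).getLast (by simp)).tgt with hy
    have hL := L_pos (k + 1 : ℤ)
    have htgt_mem : g.tgt ∈ S.block g'.src := by
      rw [hbl]; exact S.mem_block_self (hS.tgt_mem g hg)
    have hnl : ¬ S.IsLocal (S.block g.src) g := hmid g (by simp)
    have hDl := hS.extent_of_not_isLocal hk hg hsrc hnl hD
    simp only [listBudget, ← hDp, ← htp]
    have hbud : jumpCost k = 7 / 25 * L (k + 1) ^ psi := rfl
    have hl2 := pot_loop_far hL.le hDl ht'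
    have hb0 : 0 ≤ pot D - jumpCost k + pot t' := by
      have := le_pot_loop hL.le hDl
      have := pot_nonneg (by linarith : 0 ≤ t')
      linarith
    -- The extent is defined by inverting `pot` on the remaining budget; lower bounds on that budget
    -- become lower bounds on `t`.
    obtain ⟨t, ht0, htt⟩ := exists_pot_eq hb0
    have hDt : D + t' ≤ t := le_of_pot_le ht0 (by linarith)
    refine ⟨t, by linarith, htt, ?_⟩
    have hfirst : ∀ z ∈ S.supp g, ∀ a ∈ S.block g.src,
        dist1 a z + dist1 z y ≤ t + 2 * L (k + 1) := fun z hz a ha => by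
      have := hD z hz
      have := dist1_triangle a g.src z
      have := diam_block hk hsrc ha hself
      have := dist1_triangle z g.tgt y
      have := htd _ htgt_mem
      linarith
    -- If the step returns to its block, the estimate for the remainder applies unchanged with the
    -- same base block. Otherwise the move to another block uses the additional `2 * L (k + 1)`
    -- gained from `pot_far_far`.
    by_cases hloop : g.tgt ∈ S.block g.src
    · have hbl' : S.block g'.src = S.block g.src := by
        rw [hbl]; exact S.block_eq_of_mem (hS.src_mem g hg) hloop
      rw [hbl'] at htd htz
      refine ⟨fun a ha => by linarith [htd a ha], ?_⟩
      intro z hz a ha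
      rw [mem_listSupp_cons_cons, ← hbl, hbl'] at hz
      rcases hz with hz | hz | hz | hz
      · linarith [htz z (.inl hz) a ha]
      · exact hfirst z hz a ha
      · linarith [htz z (.inl hz) a ha]
      · linarith [htz z (.inr hz) a ha]
    · have hfar := far_of_not_mem_block hk hsrc (hS.tgt_mem g hg) hloop hself
      have hff := pot_far_far hL.le (hfar.trans hDd) ht'
      have hDt2 : D + t' + 2 * L (k + 1) ≤ t := le_of_pot_le ht0 (by linarith)
      have hdist : ∀ a ∈ S.block g.src, dist1 a y ≤ t + L (k + 1) := fun a ha => by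
        have := dist1_triangle a g.src y
        have := dist1_triangle g.src g.tgt y
        have := diam_block hk hsrc ha hself
        have := htd _ htgt_mem
        linarith
      refine ⟨hdist, ?_⟩
      intro z hz a ha
      have hrest : (z ∈ S.block g'.src ∨ z ∈ S.listSupp (g' :: l)) →
          dist1 a z + dist1 z y ≤ t + 2 * L (k + 1) := fun hz => by
        have := htz z hz _ htgt_mem
        have := dist1_triangle a g.src z
        have := dist1_triangle g.src g.tgt z
        have := diam_block hk hsrc ha hself
        linarith
      rw [mem_listSupp_cons_cons, ← hbl] at hz
      rcases hz with hz | hz | hz | hz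
      · linarith [hdist z hz, diam_block hk hsrc ha hz]
      · exact hfirst z hz a ha
      · exact hrest (.inl hz)
      · exact hrest (.inr hz)

/-- The extent of a walk through removed blocks, at a positive level. -/
theorem Regular.extent_walk (hS : S.Regular) (hk : k ≠ 0) {g g' : Multigraph d k}
    {l : List (Multigraph d k)} (hadm : ∀ h ∈ g :: g' :: l, S.adm h)
    (hch : (g :: g' :: l).IsChain (S.Linked γ E)) (hsrc : g.src ∈ S.nextR γ E)
    (htgt : ((g' :: l).getLast (by simp)).tgt ∈ S.nextR γ E)
    (hmid : ∀ h ∈ (g' :: l).dropLast, ¬ S.IsLocal (S.block h.src) h) :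
    ∃ D, 8 * L (k + 1) ≤ D ∧
      pot D = listBudget (jumpCost k) (Multigraph.budget k) (g :: g' :: l) ∧
      ∀ z ∈ S.listSupp (g :: g' :: l),
        dist1 g.src z + dist1 z ((g' :: l).getLast (by simp)).tgt ≤ D := by
  have hg := hadm g (by simp)
  obtain ⟨D, hD0, hDp, hD⟩ := hS.extent g hg
  have hDd := hS.dist_src_tgt_le hg hD
  rw [List.isChain_cons_cons] at hch
  have hsrc' := mem_sdiff_nextR_of_mem_block hch.1.1 hch.1.2
  have hbl : S.block g'.src = S.block g.tgt := S.block_eq_of_mem (hS.tgt_mem g hg) hch.1.2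
  obtain ⟨t', ht', htp, htd, htz⟩ := hS.extent_remainder hk l g'
    (fun h hh => hadm h (List.mem_cons_of_mem _ hh)) hch.2 hsrc' htgt hmid
  have hL := L_pos (k + 1 : ℤ)
  have hself := S.mem_block_self (hS.tgt_mem g hg)
  have htgt_mem : g.tgt ∈ S.block g'.src := by rwa [hbl]
  have hfar := far_of_not_mem_block hk hch.1.1 (hS.src_mem g hg)
      (not_mem_block_of_mem_nextR hch.1.1 hsrc) hself
  rw [dist1_comm] at hfar
  -- The walk starts outside the removed blocks, so its first step also spans the separation. The
  -- gain `2 * L (k + 1)` absorbs the slack that `extent_remainder` leaves open.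
  have hff := pot_far_far hL.le (hfar.trans hDd) ht'
  have hbud : jumpCost k = 7 / 25 * L (k + 1) ^ psi := rfl
  simp only [listBudget, ← hDp, ← htp]
  have hb0 : 0 ≤ pot D - jumpCost k + pot t' := by
    have := pot_nonneg (by linarith : 0 ≤ D + t' + 2 * L (k + 1))
    linarith
  obtain ⟨t, ht0, htt⟩ := exists_pot_eq hb0
  have hDt : D + t' + 2 * L (k + 1) ≤ t := le_of_pot_le ht0 (by linarith)
  refine ⟨t, by linarith, htt, ?_⟩
  intro z hz
  set y := ((g' :: l).getLast (by simp)).tgt with hy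
  have hrest : (z ∈ S.block g'.src ∨ z ∈ S.listSupp (g' :: l)) →
      dist1 g.src z + dist1 z y ≤ t := fun hz => by
    have := htz z hz _ htgt_mem
    have := dist1_triangle g.src g.tgt z
    linarith
  rw [mem_listSupp_cons_cons, ← hbl] at hz
  rcases hz with hz | hz | hz
  · have := hD z hz
    have := dist1_triangle z g.tgt y
    have := htd _ htgt_mem
    linarith
  · exact hrest (.inl hz)
  · exact hrest (.inr hz)

/-- A step that leaves `R^(k+1)`, enters it, or starts outside of it and is not local. -/
def Passing (S : Stage d k) (γ E : ℝ) (g : Multigraph d k) : Prop :=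
  (g.src ∈ S.nextR γ E ∧ g.tgt ∈ S.R \ S.nextR γ E) ∨
    (g.src ∈ S.R \ S.nextR γ E ∧ g.tgt ∈ S.nextR γ E) ∨
    (g.src ∈ S.R \ S.nextR γ E ∧ ¬ S.IsLocal (S.block g.src) g)

theorem Regular.extent_of_passing (hS : S.Regular) (hk : k ≠ 0) {g : Multigraph d k}
    (hg : S.adm g) (hp : S.Passing γ E g) {D : ℝ}
    (hD : ∀ z ∈ S.supp g, dist1 g.src z + dist1 z g.tgt ≤ D) : L (k + 1) / 2 ≤ D := by
  have hDd := hS.dist_src_tgt_le hg hD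
  have hL := L_pos (k + 1 : ℤ)
  rcases hp with ⟨h1, h2⟩ | ⟨h1, h2⟩ | ⟨h1, h2⟩
  · have := far_of_not_mem_block hk h2 (hS.src_mem g hg) (not_mem_block_of_mem_nextR h2 h1)
      (S.mem_block_self (hS.tgt_mem g hg))
    rw [dist1_comm] at this
    linarith
  · have := far_of_not_mem_block hk h1 (hS.tgt_mem g hg) (not_mem_block_of_mem_nextR h1 h2)
      (S.mem_block_self (hS.src_mem g hg))
    linarith
  · exact hS.extent_of_not_isLocal hk hg h1 h2 hD

theorem Regular.one_le_extent_of_passing {S : Stage d 0} (hS : S.Regular)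
    {g : Multigraph d 0} (hg : S.adm g) (hp : S.Passing γ E g) {D : ℝ}
    (hD : ∀ z ∈ S.supp g, dist1 g.src z + dist1 z g.tgt ≤ D) : 1 ≤ D := by
  have hDd := hS.dist_src_tgt_le hg hD
  by_cases hne : g.src = g.tgt
  · rcases hp with ⟨h1, h2⟩ | ⟨h1, h2⟩ | ⟨h1, h2⟩
    · rw [hne] at h1
      exact absurd h1 (Finset.mem_sdiff.1 h2).2
    · rw [hne] at h1
      exact absurd h2 (Finset.mem_sdiff.1 h1).2
    -- The locality radius is positive and the block is a single position, so a non-local loop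
    -- contains a second lattice point.
    · simp only [IsLocal, block_zero, Finset.mem_singleton, true_and, hne.symm] at h2
      push Not at h2
      obtain ⟨z, hz, hzz⟩ := h2
      have h3 := hzz _ rfl
      have h4 : z ≠ g.src := by
        rintro rfl
        rw [dist1_self] at h3
        exact absurd (L_pos _) h3.not_gt
      have := hD z hz
      have := one_le_dist1 h4
      have := dist1_nonneg z g.tgt
      rw [dist1_comm z] at *
      linarith
  · exact (one_le_dist1 hne).trans hDd

/-- Each step of a walk through removed blocks pays for a jump. -/
theorem Regular.jumpCost_le_budget (hS : S.Regular) {g : Multigraph d k}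
    (hg : S.adm g) (hp : S.Passing γ E g) : jumpCost k ≤ g.budget k := by
  obtain ⟨D, hD0, hDp, hD⟩ := hS.extent g hg
  by_cases hk : k = 0
  · subst hk
    have h1 := pot_mono zero_le_one (hS.one_le_extent_of_passing hg hp hD)
    rw [pot_one, hDp] at h1
    have : jumpCost 0 = 7 / 25 := by simp [jumpCost, scaleExp, L]
    linarith
  · rw [← hDp]
    exact le_pot_loop (L_pos _).le (hS.extent_of_passing hk hg hp hD)

/-- The extent of a walk at level `0`. -/
theorem Regular.extent_walk_zero {S : Stage d 0} (hS : S.Regular) :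
    ∀ (l : List (Multigraph d 0)) (g : Multigraph d 0), (∀ h ∈ g :: l, S.adm h) →
      (g :: l).IsChain (S.Linked γ E) → (∀ h ∈ g :: l, S.Passing γ E h) →
      ∃ t : ℝ, (l.length : ℝ) + 1 ≤ t ∧
        pot t = listBudget (jumpCost 0) (Multigraph.budget 0) (g :: l) ∧
        ∀ z ∈ S.listSupp (g :: l),
          dist1 g.src z + dist1 z ((g :: l).getLast (by simp)).tgt ≤ t
  | [], g, hadm, _, hp => by
    have hg := hadm g (by simp)
    obtain ⟨D, hD0, hDp, hD⟩ := hS.extent g hg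
    have h1 := hS.one_le_extent_of_passing hg (hp g (by simp)) hD
    refine ⟨D, by simpa using h1, hDp, fun z hz => ?_⟩
    rw [mem_listSupp_singleton] at hz
    exact hD z hz
  | g' :: l, g, hadm, hch, hp => by
    have hg := hadm g (by simp)
    obtain ⟨D, hD0, hDp, hD⟩ := hS.extent g hg
    have h1 := hS.one_le_extent_of_passing hg (hp g (by simp)) hD
    have hDd := hS.dist_src_tgt_le hg hD
    rw [List.isChain_cons_cons] at hch
    have heq : g'.src = g.tgt := by simpa [block_zero] using hch.1.2
    have hg' := hadm g' (by simp)
    obtain ⟨t', ht', htp, htz⟩ := hS.extent_walk_zero l g'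
      (fun h hh => hadm h (List.mem_cons_of_mem _ hh)) hch.2
      (fun h hh => hp h (List.mem_cons_of_mem _ hh))
    simp only [List.getLast_cons_cons]
    set y := ((g' :: l).getLast (by simp)).tgt with hy
    have hl0 : (0 : ℝ) ≤ l.length := Nat.cast_nonneg _
    have hJ : jumpCost 0 = 7 / 25 := by simp [jumpCost, scaleExp, L]
    have hpp := pot_one_one h1 (by linarith : 1 ≤ t')
    simp only [listBudget, ← hDp, ← htp]
    have hb0 : 0 ≤ pot D - jumpCost 0 + pot t' := by
      have := pot_nonneg (by linarith : 0 ≤ D + t')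
      linarith
    obtain ⟨t, ht0, htt⟩ := exists_pot_eq hb0
    have hDt : D + t' ≤ t := le_of_pot_le ht0 (by linarith)
    refine ⟨t, by push_cast [List.length_cons]; linarith, htt, fun z hz => ?_⟩
    have hsrc : g'.src ∈ S.listSupp (g' :: l) := .inl ⟨g', by simp, hS.src_supp g' hg'⟩
    have hrest : z ∈ S.listSupp (g' :: l) → dist1 g.src z + dist1 z y ≤ t := fun hz => by
      have := htz z hz
      rw [heq] at this
      have := dist1_triangle g.src g.tgt z
      linarith
    rw [mem_listSupp_cons_cons, block_zero, Finset.mem_singleton] at hz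
    rcases hz with hz | hz | hz
    · have := hD z hz
      have h2 := htz _ hsrc
      rw [dist1_self, zero_add, heq] at h2
      have := dist1_triangle z g.tgt y
      linarith
    · exact hrest (by rw [hz, ← heq]; exact hsrc)
    · exact hrest hz

/-! ### Walks -/

theorem Linked.chain_src {l : List (Multigraph d k)} {g : Multigraph d k}
    (h : (g :: l).IsChain (S.Linked γ E)) : ∀ g' ∈ l, g'.src ∈ S.R \ S.nextR γ E := by
  induction l generalizing g with
  | nil => simp
  | cons g' l ih =>
    rw [List.isChain_cons_cons] at h
    intro g'' hg''
    rcases List.mem_cons.1 hg'' with rfl | hm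
    · exact mem_sdiff_nextR_of_mem_block h.1.1 h.1.2
    · exact ih h.2 _ hm

/-- The properties of a walk `b, vs, c` through removed blocks. -/
theorem nextAdm_through {b c : Multigraph d k} {vs : List (Multigraph d k)}
    (h : S.nextAdm γ E (.through b vs c)) :
    (∀ g ∈ b :: (vs ++ [c]), S.adm g ∧ S.Passing γ E g) ∧ b.src ∈ S.nextR γ E ∧
      c.tgt ∈ S.nextR γ E ∧ (b :: (vs ++ [c])).IsChain (S.Linked γ E) ∧
      ∀ g ∈ vs, ¬ S.IsLocal (S.block g.src) g := by
  obtain ⟨h1, h2, h3, h4, h5⟩ := h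
  change (b :: (vs ++ [c])).IsChain (S.Linked γ E) at h4
  refine ⟨fun g hg => ⟨h1 g hg, ?_⟩, h2, h3, h4, h5⟩
  have hs := Linked.chain_src h4
  rcases List.mem_cons.1 hg with rfl | hm
  · refine .inl ⟨h2, ?_⟩
    cases vs with
    | nil => exact (List.isChain_cons_cons.1 h4).1.1
    | cons v vs => exact (List.isChain_cons_cons.1 h4).1.1
  · rcases List.mem_append.1 hm with hm' | hm'
    · exact .inr (.inr ⟨hs g hm, h5 g hm'⟩)
    · rw [List.mem_singleton] at hm'
      subst hm'
      exact .inr (.inl ⟨hs g hm, h3⟩)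

/-- Both lower bounds serve the energy dependence: `2 ≤ D` gives budget `9/8`, and `L (k + 1) ≤ D`
gives three times the exponent of the resolvent. -/
theorem Regular.extent_through (hS : S.Regular) {b c : Multigraph d k}
    {vs : List (Multigraph d k)} (h : S.nextAdm γ E (.through b vs c)) :
    ∃ D, 2 ≤ D ∧ L (k + 1) ≤ D ∧
      pot D = Multigraph.budget (k + 1) (.through b vs c) ∧
      ∀ z ∈ S.listSupp (b :: (vs ++ [c])), dist1 b.src z + dist1 z c.tgt ≤ D := by
  obtain ⟨h1, h2, h3, h4, h5⟩ := nextAdm_through h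
  have hlast : (vs ++ [c]).getLast (by simp) = c := List.getLast_append_singleton _
  have hbud : Multigraph.budget (d := d) (k + 1) (.through b vs c) =
    listBudget (jumpCost k) (Multigraph.budget k) (b :: (vs ++ [c])) := rfl
  rw [hbud]
  by_cases hk : k = 0
  · subst hk
    obtain ⟨t, ht, htp, htz⟩ := hS.extent_walk_zero (vs ++ [c]) b (fun g hg => (h1 g hg).1) h4
      (fun g hg => (h1 g hg).2)
    rw [List.getLast_cons (by simp), hlast] at htz
    have : (0 : ℝ) ≤ vs.length := Nat.cast_nonneg _
    simp only [List.length_append, List.length_singleton, Nat.cast_add, Nat.cast_one] at ht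
    refine ⟨t, by linarith, ?_, htp, htz⟩
    have : L ((0 : ℕ) + 1) = 1 := by simp [L]
    rw [this]; linarith
  · obtain ⟨g', l, hl⟩ : ∃ g' l, vs ++ [c] = g' :: l := by
      cases vs with
      | nil => exact ⟨c, [], rfl⟩
      | cons v vs => exact ⟨v, vs ++ [c], rfl⟩
    have hdl : ∀ g ∈ (g' :: l).dropLast, ¬ S.IsLocal (S.block g.src) g := by
      rw [← hl, List.dropLast_concat]; exact h5
    have hlast' : (g' :: l).getLast (by simp) = c := by simp only [← hl, hlast]
    rw [hl] at h1 h4 ⊢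
    obtain ⟨D, hD, hDp, hDz⟩ := hS.extent_walk hk (fun g hg => (h1 g hg).1) h4 h2
      (by rw [hlast']; exact h3) hdl
    rw [hlast'] at hDz
    have h1L : 1 ≤ L (k + 1) := by rw [L_succ]; exact one_le_pow₀ (by norm_num)
    exact ⟨D, by linarith, by linarith, hDp, hDz⟩

/-- The next stage is regular. -/
theorem Regular.next (hS : S.Regular) (γ E : ℝ) : (S.next γ E).Regular := by
  have key : ∀ w : Walk (Multigraph d k), S.nextAdm γ E w →
      w.first.src ∈ S.nextSupp w ∧ w.last.tgt ∈ S.nextSupp w ∧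
      ∃ D, 0 ≤ D ∧ pot D = Multigraph.budget (k + 1) w ∧
      ∀ z ∈ S.nextSupp w, dist1 w.first.src z + dist1 z w.last.tgt ≤ D := by
    rintro (g | ⟨b, vs, c⟩) h
    · have hg : S.adm g := h.1 g (by simp [Walk.steps])
      obtain ⟨D, hD0, hDp, hD⟩ := hS.extent g hg
      refine ⟨.inl ⟨g, by simp [Walk.steps], hS.src_supp g hg⟩,
        .inl ⟨g, by simp [Walk.steps], hS.tgt_supp g hg⟩, D, hD0, hDp, fun z hz => ?_⟩
      exact hD z (mem_listSupp_singleton.1 hz)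
    · obtain ⟨D, hD, _, hDp, hDz⟩ := hS.extent_through h
      have h1 := (nextAdm_through h).1
      exact ⟨.inl ⟨b, by simp [Walk.steps], hS.src_supp b (h1 b (by simp)).1⟩,
        .inl ⟨c, by simp [Walk.steps], hS.tgt_supp c (h1 c (by simp)).1⟩, D, by linarith,
        hDp, hDz⟩
  exact ⟨fun g hg => hg.2.1, fun g hg => hg.2.2.1, fun g hg => (key g hg).1,
    fun g hg => (key g hg).2.1, fun g hg => (key g hg).2.2⟩

end Stage

theorem stageZero_regular {d : ℕ} (γ : ℝ) (Λ : Finset (Pos d)) (u : Pos d → ℝ) :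
    (stageZero γ Λ u).Regular where
  src_mem _ h := h.1
  tgt_mem _ h := h.2.1
  src_supp _ _ := .inl rfl
  tgt_supp _ _ := .inr rfl
  extent := by
    rintro ⟨x, y⟩ ⟨_, _, h⟩
    by_cases hxy : x = y
    · subst hxy
      refine ⟨0, le_rfl, by simp [pot_zero, Multigraph.budget], ?_⟩
      rintro z (rfl | rfl) <;> simp [Multigraph.src, Multigraph.tgt, dist1_self]
    · have h1 : dist1 x y = 1 := h.resolve_left hxy
      refine ⟨1, zero_le_one, by simp [pot_one, Multigraph.budget, hxy], ?_⟩
      rintro z (rfl | rfl) <;> simp [Multigraph.src, Multigraph.tgt, dist1_self, h1]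

theorem stage_regular {d : ℕ} (γ : ℝ) (Λ : Finset (Pos d)) (u : Pos d → ℝ) (E : ℝ) :
    ∀ k, (stage γ Λ u E k).Regular
  | 0 => stageZero_regular γ Λ u
  | k + 1 => (stage_regular γ Λ u E k).next γ E

open scoped ENNReal

/-! ### Sums over multigraphs -/

/-- A list is empty or consists of a first element and a list. -/
def listEquivOption (G : Type) : Option (G × List G) ≃ List G where
  toFun o := o.elim [] fun p => p.1 :: p.2
  invFun
    | [] => none
    | g :: l => some (g, l)
  left_inv o := by cases o <;> rfl
  right_inv l := by cases l <;> rfl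

theorem tsum_list {G : Type} (F : List G → ℝ≥0∞) :
    ∑' l, F l = F [] + ∑' g, ∑' l, F (g :: l) := by
  rw [← (listEquivOption G).tsum_eq, ENNReal.tsum_eq_add_tsum_ite none]
  refine congr_arg₂ _ rfl ?_
  rw [← ENNReal.tsum_prod (f := fun g l => F (g :: l)),
    ← (Option.some_injective (G × List G)).tsum_eq]
  · exact tsum_congr fun p => if_neg (by simp)
  · rintro (_ | p) h
    · simp at h
    · exact ⟨p, rfl⟩

namespace Stage

variable {d k : ℕ}

open scoped Classical in
/-- The contribution of a list of steps to the sum of the factors of walks. -/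
noncomputable def listTerm (S : Stage d k) (γ E : ℝ) : List (Multigraph d k) → ℝ≥0∞
  | [] => 0
  | [g] => if S.adm g then ENNReal.ofReal (g.factor γ k) else 0
  | g :: g' :: l =>
    if S.adm g ∧ S.Linked γ E g g' then
      ENNReal.ofReal (g.factor γ k) * ENNReal.ofReal (jumpFactor γ k) *
        S.listTerm γ E (g' :: l)
    else 0

/-- `listTerm` tests admissibility and linking one step at a time, so that sums over lists
factorise; on admissible chains nothing is lost. -/
theorem listTerm_eq (S : Stage d k) {γ E : ℝ} (hγ : 0 ≤ γ) :
    ∀ (l : List (Multigraph d k)) (g : Multigraph d k), (∀ h ∈ g :: l, S.adm h) →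
      (g :: l).IsChain (S.Linked γ E) → S.listTerm γ E (g :: l) =
        ENNReal.ofReal (listFactor (jumpFactor γ k) (Multigraph.factor γ k) (g :: l))
  | [], g, hadm, _ => by simp [listTerm, listFactor, hadm g (by simp)]
  | g' :: l, g, hadm, hch => by
    rw [List.isChain_cons_cons] at hch
    rw [listTerm, if_pos ⟨hadm g (by simp), hch.1⟩, listFactor,
      S.listTerm_eq hγ l g' (fun h hh => hadm h (List.mem_cons_of_mem _ hh)) hch.2,
      ENNReal.ofReal_mul (mul_nonneg (Multigraph.factor_nonneg hγ _ _)
        (jumpFactor_nonneg hγ _)), ENNReal.ofReal_mul (Multigraph.factor_nonneg hγ _ _)]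

open scoped Classical in
/-- The sum of the factors of the multigraphs that start at `x`. -/
noncomputable def factorSum (S : Stage d k) (γ : ℝ) (x : Pos d) : ℝ≥0∞ :=
  ∑' g : Multigraph d k, if S.adm g ∧ g.src = x then ENNReal.ofReal (g.factor γ k) else 0

open scoped Classical in
/-- The sum over lists with first step `g` and at most `n` further steps. -/
noncomputable def listSum (S : Stage d k) (γ E : ℝ) (n : ℕ) (g : Multigraph d k) : ℝ≥0∞ :=
  ∑' l : List (Multigraph d k), if l.length ≤ n then S.listTerm γ E (g :: l) else 0

open scoped Classical in
theorem listSum_zero (S : Stage d k) (γ E : ℝ) (g : Multigraph d k) :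
    S.listSum γ E 0 g = S.listTerm γ E [g] := by
  rw [listSum, tsum_list]
  simp

open scoped Classical in
theorem listSum_succ (S : Stage d k) (γ E : ℝ) (n : ℕ) (g : Multigraph d k) :
    S.listSum γ E (n + 1) g = (if S.adm g then ENNReal.ofReal (g.factor γ k) else 0) *
      (1 + ENNReal.ofReal (jumpFactor γ k) *
        ∑' g', if S.Linked γ E g g' then S.listSum γ E n g' else 0) := by
  rw [listSum, tsum_list, mul_add, mul_one]
  congr 1
  by_cases h' : S.adm g
  swap
  · simp [h', listTerm]
  · rw [if_pos h', ← mul_assoc, ← ENNReal.tsum_mul_left]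
    congr 1 with g'
    simp only [listSum, List.length_cons, Nat.add_le_add_iff_right]
    by_cases h : S.Linked γ E g g'
    · simp only [h, h', if_true, ← ENNReal.tsum_mul_left, listTerm, and_self]
      congr 1 with l
      split_ifs <;> simp
    · simp [h, listTerm]

-- `M` is a supersolution of the recursion that peels off the first step: `K` bounds the choices of
-- this step, and the next one starts at one of at most `2 ^ k` positions of a removed block.
-- Truncating the length makes induction possible.
open scoped Classical in
theorem sum_listSum_le (S : Stage d k) {γ E : ℝ} {K M : ℝ≥0∞}
    (hK : ∀ x, S.factorSum γ x ≤ K)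
    (hM : K * (1 + ENNReal.ofReal (jumpFactor γ k) * (2 ^ k * M)) ≤ M) (n : ℕ) (x : Pos d) :
    ∑' g : Multigraph d k, (if g.src = x then S.listSum γ E n g else 0) ≤ M := by
  have hKM : K ≤ M := le_trans (by rw [mul_add, mul_one]; exact le_self_add) hM
  induction n generalizing x with
  | zero =>
    refine le_trans (le_of_eq ?_) ((hK x).trans hKM)
    unfold factorSum
    congr 1 with g
    rw [listSum_zero, listTerm]
    by_cases h1 : S.adm g <;> by_cases h2 : g.src = x <;> simp [h1, h2]
  | succ n ih =>
    refine le_trans ?_ hM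
    refine le_trans ?_ (mul_le_mul_left (hK x) _)
    unfold factorSum
    rw [← ENNReal.tsum_mul_right]
    refine ENNReal.tsum_le_tsum fun g => ?_
    by_cases h1 : g.src = x
    swap
    · simp [h1]
    by_cases h2 : S.adm g
    swap
    · simp [h1, h2, listSum_succ]
    rw [if_pos h1, if_pos ⟨h2, h1⟩, listSum_succ, if_pos h2]
    gcongr
    by_cases h3 : g.tgt ∈ S.R \ S.nextR γ E
    swap
    · simp [Linked, h3]
    calc ∑' g', (if S.Linked γ E g g' then S.listSum γ E n g' else 0)
        ≤ ∑' g', ∑ y ∈ S.block g.tgt, (if g'.src = y then S.listSum γ E n g' else 0) := by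
          refine ENNReal.tsum_le_tsum fun g' => ?_
          split_ifs with h
          · rw [Finset.sum_ite_eq, if_pos h.2]
          · exact zero_le
      _ = ∑ y ∈ S.block g.tgt, ∑' g', (if g'.src = y then S.listSum γ E n g' else 0) :=
          Summable.tsum_finsetSum fun _ _ => ENNReal.summable
      _ ≤ ∑ y ∈ S.block g.tgt, M := Finset.sum_le_sum fun y _ => ih y
      _ = ((S.block g.tgt).card : ℝ≥0∞) * M := by rw [Finset.sum_const, nsmul_eq_mul]
      _ ≤ 2 ^ k * M := by
          gcongr
          exact_mod_cast card_block_le h3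

-- A finite partial sum contains lists of bounded length only, so the truncated bound, uniform in
-- `n`, passes to the supremum.
open scoped Classical in
theorem sum_listTerm_le (S : Stage d k) {γ E : ℝ} {K M : ℝ≥0∞}
    (hK : ∀ x, S.factorSum γ x ≤ K)
    (hM : K * (1 + ENNReal.ofReal (jumpFactor γ k) * (2 ^ k * M)) ≤ M) (x : Pos d) :
    ∑' g : Multigraph d k, ∑' l,
      (if g.src = x then S.listTerm γ E (g :: l) else 0) ≤ M := by
  rw [← ENNReal.tsum_prod, ENNReal.tsum_eq_iSup_sum]
  refine iSup_le fun s => ?_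
  let n := s.sup fun p => p.2.length
  refine le_trans ?_ (S.sum_listSum_le (E := E) hK hM n x)
  calc ∑ p ∈ s, (if p.1.src = x then S.listTerm γ E (p.1 :: p.2) else 0)
      ≤ ∑ p ∈ s, (if p.1.src = x then
          (if p.2.length ≤ n then S.listTerm γ E (p.1 :: p.2) else 0) else 0) := by
        refine Finset.sum_le_sum fun p hp => ?_
        rw [if_pos (Finset.le_sup (f := fun p : Multigraph d k × List (Multigraph d k) =>
          p.2.length) hp : p.2.length ≤ n)]
    _ ≤ ∑' p : Multigraph d k × List (Multigraph d k), (if p.1.src = x then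
          (if p.2.length ≤ n then S.listTerm γ E (p.1 :: p.2) else 0) else 0) :=
        ENNReal.sum_le_tsum s
    _ = _ := by
        rw [ENNReal.tsum_prod']
        congr 1 with g
        split_ifs
        · rfl
        · simp

theorem steps_injective {G : Type} : Function.Injective (Walk.steps (G := G)) := by
  rintro (g | ⟨b, vs, c⟩) (g' | ⟨b', vs', c'⟩) h
  · simp_all [Walk.steps]
  · simp [Walk.steps] at h
  · simp [Walk.steps] at h
  · simp only [Walk.steps, List.cons.injEq] at h
    obtain ⟨h1, h2⟩ := List.append_inj' h.2 rfl
    simp_all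

-- A walk is determined by its steps, so walks embed into lists. Dropping the remaining conditions
-- on the walk, such as non-locality, only enlarges the sum.
open scoped Classical in
theorem factorSum_next_le (S : Stage d k) {γ E : ℝ} (hγ : 0 ≤ γ) {K M : ℝ≥0∞}
    (hK : ∀ x, S.factorSum γ x ≤ K)
    (hM : K * (1 + ENNReal.ofReal (jumpFactor γ k) * (2 ^ k * M)) ≤ M) (x : Pos d) :
    (S.next γ E).factorSum γ x ≤ M := by
  let F : List (Multigraph d k) → ℝ≥0∞
    | [] => 0
    | g :: l => if g.src = x then S.listTerm γ E (g :: l) else 0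
  have h1 : ∑' l, F l ≤ M := by
    rw [tsum_list]
    simpa [F] using S.sum_listTerm_le hK hM x
  refine le_trans ?_ h1
  refine le_trans ?_ (ENNReal.tsum_comp_le_tsum_of_injective steps_injective F)
  refine ENNReal.tsum_le_tsum fun w => ?_
  split_ifs with h
  swap
  · exact zero_le
  obtain ⟨⟨ha, _, _, hc, _⟩, hx⟩ := h
  change w.steps.IsChain (S.Linked γ E) at hc
  cases w with
  | direct g =>
    change g.src = x at hx
    change _ ≤ F [g]
    simp only [F, hx, if_true]
    rw [S.listTerm_eq hγ _ _ ha hc]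
    rfl
  | through b vs c =>
    change b.src = x at hx
    change _ ≤ F (b :: (vs ++ [c]))
    simp only [F, hx, if_true]
    rw [S.listTerm_eq hγ _ _ ha hc]
    rfl

end Stage

/-- The points at distance at most one of `x`. -/
theorem mem_Icc_of_dist1_le {d : ℕ} {x y : Pos d} (h : dist1 x y ≤ 1) :
    y ∈ Finset.Icc (x - 1) (x + 1) := by
  have h1 : ∀ i, |x i - y i| ≤ 1 := fun i => by
    have h2 : |x i - y i| ≤ ∑ i, |x i - y i| :=
      Finset.single_le_sum (f := fun i => |x i - y i|) (fun i _ => abs_nonneg _)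
        (Finset.mem_univ i)
    unfold dist1 at h
    exact h2.trans (by exact_mod_cast h)
  rw [Finset.mem_Icc]
  constructor <;> intro i <;> have := abs_le.1 (h1 i) <;>
    simp only [Pi.sub_apply, Pi.add_apply, Pi.one_apply] <;> omega

theorem card_Icc_unit {d : ℕ} (x : Pos d) : (Finset.Icc (x - 1) (x + 1)).card = 3 ^ d := by
  rw [Pi.card_Icc]
  have : ∀ i, (Finset.Icc ((x - 1) i) ((x + 1) i)).card = 3 := fun i => by
    rw [Int.card_Icc]
    simp only [Pi.sub_apply, Pi.add_apply, Pi.one_apply]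
    omega
  rw [Finset.prod_congr rfl fun i _ => this i, Finset.prod_const, Finset.card_univ,
    Fintype.card_fin]

-- The diagonal entry contributes 3; the neighbours lie in a cube of `3 ^ d` points and contribute
-- `γ^(1/4)` each. This count is why `γ₀` depends on `d`.
open scoped Classical in
theorem stageZero_factorSum_le {d : ℕ} {γ : ℝ} (hγ : 0 ≤ γ)
    (h : 3 ^ d * γ ^ (1 / 4 : ℝ) ≤ 1 / 4)
    (Λ : Finset (Pos d)) (u : Pos d → ℝ) (x : Pos d) :
    (stageZero γ Λ u).factorSum γ x ≤ ENNReal.ofReal (13 / 4) := by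
  have h1 : (stageZero γ Λ u).factorSum γ x ≤ ∑' p : Pos d × Pos d,
      if p.1 = x ∧ dist1 x p.2 ≤ 1 then ENNReal.ofReal (Multigraph.factor γ 0 p) else 0 := by
    refine ENNReal.tsum_le_tsum fun (p : Pos d × Pos d) => ?_
    by_cases h : (stageZero γ Λ u).adm p ∧ Multigraph.src 0 p = x
    · obtain ⟨⟨_, _, h2⟩, h3⟩ := h
      change p.1 = x at h3
      have h4 : p.1 = x ∧ dist1 x p.2 ≤ 1 := by
        refine ⟨h3, ?_⟩
        rcases h2 with h2 | h2
        · rw [← h3, ← h2, dist1_self]; exact zero_le_one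
        · rw [← h3, h2]
      rw [if_pos h4]
      split_ifs
      · exact le_rfl
      · exact zero_le
    · rw [if_neg h]; exact zero_le
  refine h1.trans ?_
  rw [ENNReal.tsum_prod', tsum_eq_single x (fun y hy => by simp [hy])]
  rw [tsum_eq_sum (s := Finset.Icc (x - 1) (x + 1))
    (fun y hy => if_neg fun h => hy (mem_Icc_of_dist1_le h.2))]
  calc _ ≤ ∑ y ∈ Finset.Icc (x - 1) (x + 1), ((if x = y then ENNReal.ofReal 3 else 0) +
        ENNReal.ofReal (γ ^ (1 / 4 : ℝ))) := by
        refine Finset.sum_le_sum fun y _ => ?_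
        by_cases hxy : x = y
        · simp only [hxy, Multigraph.factor, if_true]
          split_ifs
          · exact le_self_add
          · exact zero_le
        · simp only [hxy, Multigraph.factor, if_false, zero_add]
          split_ifs
          · exact le_rfl
          · exact zero_le
    _ ≤ ENNReal.ofReal 3 + 3 ^ d * ENNReal.ofReal (γ ^ (1 / 4 : ℝ)) := by
        rw [Finset.sum_add_distrib, Finset.sum_const, card_Icc_unit, nsmul_eq_mul,
          Finset.sum_ite_eq]
        gcongr
        · split_ifs
          · exact le_rfl
          · exact zero_le
        · simp
    _ ≤ _ := by
        rw [show (3 : ℝ≥0∞) ^ d = ENNReal.ofReal (3 ^ d) by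
          rw [ENNReal.ofReal_pow (by norm_num)]; norm_num]
        rw [← ENNReal.ofReal_mul (by positivity), ← ENNReal.ofReal_add (by norm_num)
          (by positivity)]
        exact ENNReal.ofReal_le_ofReal (by linarith)

/-- The sums increase from `13/4` by geometrically decreasing amounts, so they stay below 4
uniformly in the level. -/
theorem stage_factorSum_le {d : ℕ} {γ : ℝ} (hγ : 0 < γ) (h0 : 3 ^ d * γ ^ (1 / 4 : ℝ) ≤ 1 / 4)
    (h1 : γ ^ (3 / 100 : ℝ) ≤ 2⁻¹ ^ 14) (Λ : Finset (Pos d)) (u : Pos d → ℝ) (E : ℝ) :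
    ∀ (k : ℕ) (x : Pos d),
      (stage γ Λ u E k).factorSum γ x ≤ ENNReal.ofReal (4 - 3 / 4 * (1 / 2) ^ k)
  | 0, x => by
    refine (stageZero_factorSum_le hγ.le h0 Λ u x).trans (ENNReal.ofReal_le_ofReal (by norm_num))
  | k + 1, x => by
    refine (stage γ Λ u E k).factorSum_next_le hγ.le (stage_factorSum_le hγ h0 h1 Λ u E k) ?_ x
    have hp : (0 : ℝ) < (1 / 2) ^ k := by positivity
    have hp1 : ((1 : ℝ) / 2) ^ k ≤ 1 := pow_le_one₀ (by norm_num) (by norm_num)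
    have hj := jumpFactor_mul_le hγ h1 k
    have hj0 := jumpFactor_nonneg hγ.le k
    rw [show (2 : ℝ≥0∞) ^ k = ENNReal.ofReal (2 ^ k) by
      rw [ENNReal.ofReal_pow (by norm_num)]; norm_num]
    rw [← ENNReal.ofReal_mul (by positivity), ← ENNReal.ofReal_mul hj0,
      ← ENNReal.ofReal_one, ← ENNReal.ofReal_add zero_le_one, ← ENNReal.ofReal_mul]
    · apply ENNReal.ofReal_le_ofReal
      rw [← mul_assoc]
      have e1 : ((1 : ℝ) / 2) ^ (k + 6) = (1 / 2) ^ k / 64 := by rw [pow_add]; norm_num; ring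
      have e2 : ((1 : ℝ) / 2) ^ (k + 1) = (1 / 2) ^ k / 2 := by rw [pow_add]; norm_num; ring
      rw [e1] at hj
      rw [e2]
      set p := ((1 : ℝ) / 2) ^ k
      have hq0 : 0 ≤ jumpFactor γ k * 2 ^ k := by positivity
      set q := jumpFactor γ k * 2 ^ k
      have : q * (4 - 3 / 4 * (p / 2)) ≤ p / 64 * 4 := by
        apply mul_le_mul hj <;> nlinarith
      nlinarith
    · linarith
    · have : 0 ≤ 4 - 3 / 4 * ((1 : ℝ) / 2) ^ (k + 1) := by
        have : ((1 : ℝ) / 2) ^ (k + 1) ≤ 1 := pow_le_one₀ (by norm_num) (by norm_num)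
        linarith
      positivity

/-! ### Reversal -/

/-- The reversed walk, with steps reversed by `f`. -/
def Walk.reverse {G : Type} (f : G → G) : Walk G → Walk G
  | direct g => direct (f g)
  | through b vs c => through (f c) (vs.map f).reverse (f b)

theorem Walk.steps_reverse {G : Type} (f : G → G) (w : Walk G) :
    (w.reverse f).steps = (w.steps.map f).reverse := by
  cases w <;> simp [Walk.reverse, Walk.steps]

theorem Walk.mid_reverse {G : Type} (f : G → G) (w : Walk G) :
    (w.reverse f).mid = (w.mid.map f).reverse := by
  cases w <;> simp [Walk.reverse, Walk.mid]

theorem Walk.reverse_reverse {G : Type} {f : G → G} (hf : ∀ g, f (f g) = g) (w : Walk G) :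
    (w.reverse f).reverse f = w := by
  have : f ∘ f = id := funext hf
  cases w <;> simp [Walk.reverse, hf, this]

theorem Walk.first_reverse {G : Type} (f : G → G) (w : Walk G) :
    (w.reverse f).first = f w.last := by cases w <;> rfl

theorem Walk.last_reverse {G : Type} (f : G → G) (w : Walk G) :
    (w.reverse f).last = f w.first := by cases w <;> rfl

namespace Multigraph

variable {d : ℕ}

/-- The reversed multigraph. -/
def rev : (k : ℕ) → Multigraph d k → Multigraph d k
  | 0, g => Prod.swap (α := Pos d) (β := Pos d) g
  | k + 1, g => Walk.reverse (G := Multigraph d k) (rev k) g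

theorem rev_rev : ∀ (k : ℕ) (g : Multigraph d k), g.rev.rev = g
  | 0, _ => rfl
  | k + 1, g => Walk.reverse_reverse (G := Multigraph d k) (rev_rev k) g

theorem src_rev : ∀ (k : ℕ) (g : Multigraph d k), g.rev.src = g.tgt
  | 0, _ => rfl
  | k + 1, g => (congrArg (src k)
      (Walk.first_reverse (G := Multigraph d k) (rev k) g)).trans (src_rev k _)

theorem tgt_rev (k : ℕ) (g : Multigraph d k) : g.rev.tgt = g.src := by
  rw [← src_rev, rev_rev]

end Multigraph

/-- `chainWeight` peels off the first step; reversal requires peeling off the last one. -/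
theorem chainWeight_append {G : Type} (r : G → G → Matrix (Fin 2) (Fin 2) ℝ)
    (w : G → Matrix (Fin 2) (Fin 2) ℝ) (g g' : G) : ∀ l : List G,
      chainWeight r w (l ++ [g, g']) = -(chainWeight r w (l ++ [g]) * r g g' * w g')
  | [] => rfl
  | [a] => by simp [chainWeight, mul_assoc]
  | a :: b :: l => by
    have := chainWeight_append r w g g' (b :: l)
    simp only [List.cons_append] at this ⊢
    rw [chainWeight, this, chainWeight]
    simp [mul_assoc]

theorem chainWeight_reverse {G : Type} {r : G → G → Matrix (Fin 2) (Fin 2) ℝ}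
    {w : G → Matrix (Fin 2) (Fin 2) ℝ} {f : G → G} : ∀ l : List G,
      (∀ g ∈ l, w (f g) = (w g).transpose) →
      l.IsChain (fun g g' => r (f g') (f g) = (r g g').transpose) →
      chainWeight r w (l.map f).reverse = (chainWeight r w l).transpose
  | [], _, _ => by simp [chainWeight]
  | [g], hw, _ => by simp [chainWeight, hw g (by simp)]
  | g :: g' :: l, hw, hr => by
    rw [List.isChain_cons_cons] at hr
    have ih := chainWeight_reverse (g' :: l) (fun h hh => hw h (.tail _ hh)) hr.2
    rw [List.map_cons, List.reverse_cons] at ih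
    rw [List.map_cons, List.map_cons, List.reverse_cons, List.reverse_cons, List.append_assoc,
      List.singleton_append, chainWeight_append, ih, chainWeight, hr.1, hw g (by simp)]
    simp [Matrix.transpose_mul, mul_assoc]

namespace Stage

variable {d k : ℕ}

/-- The invariance of a stage under reversal of multigraphs. -/
structure Reversible (S : Stage d k) : Prop where
  adm_rev : ∀ g, S.adm g → S.adm g.rev
  supp_rev : ∀ g, S.adm g → S.supp g.rev = S.supp g
  wt_rev : ∀ lam g, S.adm g → S.wt lam g.rev = (S.wt lam g).transpose

variable {S : Stage d k} {γ E : ℝ}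

theorem Reversible.isLocal_rev (hS : S.Reversible) {B : Finset (Pos d)} {g : Multigraph d k}
    (hg : S.adm g) : S.IsLocal B g.rev ↔ S.IsLocal B g := by
  simp only [IsLocal, Multigraph.src_rev, Multigraph.tgt_rev, hS.supp_rev g hg]
  exact and_left_comm

/-- Reversal as a bijection of the multigraphs that contribute to a truncation. -/
def Reversible.revEquiv (hS : S.Reversible) (B : Finset (Pos d)) (x y : Pos d) :
    S.LocalGraph B x y ≃ S.LocalGraph B y x where
  toFun g := ⟨g.1.rev, hS.adm_rev _ g.2.1, (hS.isLocal_rev g.2.1).2 g.2.2.1,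
    by rw [Multigraph.src_rev, g.2.2.2.2], by rw [Multigraph.tgt_rev, g.2.2.2.1]⟩
  invFun g := ⟨g.1.rev, hS.adm_rev _ g.2.1, (hS.isLocal_rev g.2.1).2 g.2.2.1,
    by rw [Multigraph.src_rev, g.2.2.2.2], by rw [Multigraph.tgt_rev, g.2.2.2.1]⟩
  left_inv g := Subtype.ext (Multigraph.rev_rev _ _)
  right_inv g := Subtype.ext (Multigraph.rev_rev _ _)

/-- Symmetry is needed twice: for the spectral theorem behind the resolvent bound, and to run the
Schur test on row sums alone. -/
theorem Reversible.Ftilde_transpose (hS : S.Reversible) (lam : ℝ) (B : Finset (Pos d)) :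
    (S.Ftilde lam B).transpose = S.Ftilde lam B := by
  ext p q
  simp only [Ftilde, Matrix.transpose_apply, Matrix.of_apply]
  rw [← (hS.revEquiv B q.1 p.1).tsum_eq]
  exact tsum_congr fun g => by
    change _ = S.wt lam g.1.rev _ _
    rw [hS.wt_rev _ _ g.2.1, Matrix.transpose_apply]

theorem Reversible.resolvent_transpose (hS : S.Reversible) (lam : ℝ) (B : Finset (Pos d))
    (x y : Pos d) : S.resolvent lam B y x = (S.resolvent lam B x y).transpose := by
  have hsym : ((S.Ftilde lam B - lam • (1 : Matrix (↥B × Fin 2) (↥B × Fin 2) ℝ))⁻¹).transpose =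
      (S.Ftilde lam B - lam • (1 : Matrix (↥B × Fin 2) (↥B × Fin 2) ℝ))⁻¹ := by
    rw [Matrix.transpose_nonsing_inv, Matrix.transpose_sub, hS.Ftilde_transpose,
      Matrix.transpose_smul, Matrix.transpose_one]
  ext i j
  simp only [resolvent, Matrix.of_apply, Matrix.transpose_apply]
  by_cases h : x ∈ B ∧ y ∈ B
  · rw [dif_pos h, dif_pos h.symm]
    exact congr_fun₂ hsym (⟨x, h.1⟩, j) (⟨y, h.2⟩, i)
  · rw [dif_neg h, dif_neg fun h' => h h'.symm]

/-- The block of a jump can be read off from the end of the step before it or the start of the step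
after it; reversal interchanges the two. -/
theorem exists_dropLast_iff_of_isChain {G : Type} {P Q : G → Prop} : ∀ l : List G,
    l.IsChain (fun g g' => P g ↔ Q g') → ((∃ g ∈ l.dropLast, P g) ↔ ∃ g ∈ l.tail, Q g)
  | [], _ => by simp
  | [g], _ => by simp
  | g :: g' :: l, h => by
    rw [List.isChain_cons_cons] at h
    have := exists_dropLast_iff_of_isChain (g' :: l) h.2
    simp only [List.dropLast_cons_cons, List.tail_cons, List.mem_cons, exists_eq_or_imp] at this ⊢
    rw [this, h.1]

theorem Linked.block_eq {g g' : Multigraph d k} (h : S.Linked γ E g g') :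
    S.block g'.src = S.block g.tgt :=
  S.block_eq_of_mem (Finset.mem_sdiff.1 h.1).1 h.2

theorem Linked.symm {g g' : Multigraph d k} (h : S.Linked γ E g g') :
    S.Linked γ E g'.rev g.rev := by
  rw [Linked, Multigraph.tgt_rev, Multigraph.src_rev]
  exact ⟨mem_sdiff_nextR_of_mem_block h.1 h.2,
    S.mem_block_symm (Finset.mem_sdiff.1 h.1).1 h.2⟩

theorem Reversible.nextAdm_reverse (hS : S.Reversible) (hR : S.Regular)
    {w : Walk (Multigraph d k)} (hw : S.nextAdm γ E w) :
    S.nextAdm γ E (w.reverse (Multigraph.rev k)) := by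
  obtain ⟨h1, h2, h3, h4, h5⟩ := hw
  refine ⟨?_, ?_, ?_, ?_, ?_⟩
  · intro g hg
    rw [Walk.steps_reverse, List.mem_reverse, List.mem_map] at hg
    obtain ⟨g', hg', rfl⟩ := hg
    exact hS.adm_rev _ (h1 g' hg')
  · rw [Walk.first_reverse, Multigraph.src_rev]; exact h3
  · rw [Walk.last_reverse, Multigraph.tgt_rev]; exact h2
  · rw [Walk.steps_reverse, List.isChain_reverse, List.isChain_map]
    exact h4.imp fun g g' h => Linked.symm h
  · intro g hg
    rw [Walk.mid_reverse, List.mem_reverse, List.mem_map] at hg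
    obtain ⟨g', hg', rfl⟩ := hg
    have hadm : S.adm g' := h1 g' (by
      cases w with
      | direct g => simp [Walk.mid] at hg'
      | through b vs c => simp only [Walk.mid, Walk.steps] at hg' ⊢; simp [hg'])
    rw [Multigraph.src_rev, hS.isLocal_rev hadm]
    -- `nextAdm` tests locality at the block of the source, and reversal moves the test to the
    -- target. A local multigraph has both ends in one block, so the tests agree.
    intro hl
    refine h5 g' hg' ?_
    rwa [S.block_eq_of_mem (hR.tgt_mem g' hadm) hl.1]

theorem Reversible.nextSupp_reverse (hS : S.Reversible)
    {w : Walk (Multigraph d k)} (hw : S.nextAdm γ E w) :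
    S.nextSupp (w.reverse (Multigraph.rev k)) = S.nextSupp w := by
  have hch : w.steps.IsChain (S.Linked γ E) := hw.2.2.2.1
  ext z
  refine or_congr ?_ ?_
  · simp only [Walk.steps_reverse, List.mem_reverse, List.mem_map, exists_exists_and_eq_and]
    exact exists_congr fun g => and_congr_right fun hg => by rw [hS.supp_rev g (hw.1 g hg)]
  · rw [exists_dropLast_iff_of_isChain (P := fun g => z ∈ S.block g.tgt)
      (Q := fun g => z ∈ S.block g.src) w.steps
      (hch.imp fun g g' h => by rw [Linked.block_eq h])]
    rw [Walk.steps_reverse, List.dropLast_reverse, ← List.map_tail]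
    simp only [List.mem_reverse, List.mem_map, exists_exists_and_eq_and, Multigraph.tgt_rev]

theorem Reversible.nextWt_reverse (hS : S.Reversible) (lam : ℝ)
    {w : Walk (Multigraph d k)} (hw : S.nextAdm γ E w) :
    S.nextWt lam (w.reverse (Multigraph.rev k)) = (S.nextWt lam w).transpose := by
  have hch : w.steps.IsChain (S.Linked γ E) := hw.2.2.2.1
  rw [nextWt, nextWt, Walk.steps_reverse]
  refine chainWeight_reverse _ (fun g hg => hS.wt_rev lam g (hw.1 g hg)) (hch.imp ?_)
  intro g g' h
  rw [Multigraph.tgt_rev, Multigraph.src_rev, Linked.block_eq h]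
  exact hS.resolvent_transpose _ _ _ _

theorem Reversible.next (hS : S.Reversible) (hR : S.Regular) (γ E : ℝ) :
    (S.next γ E).Reversible where
  adm_rev _ hw := hS.nextAdm_reverse hR hw
  supp_rev _ hw := hS.nextSupp_reverse hw
  wt_rev lam _ hw := hS.nextWt_reverse lam hw

end Stage

theorem hamBlock_transpose {d : ℕ} (γ : ℝ) (u : Pos d → ℝ) (x y : Pos d) :
    hamBlock γ u y x = (hamBlock γ u x y).transpose := by
  unfold hamBlock
  by_cases h : x = y
  · subst h
    rw [if_pos rfl]
    ext i j
    fin_cases i <;> fin_cases j <;> rfl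
  · rw [if_neg h, if_neg (Ne.symm h), dist1_comm]
    split_ifs <;> simp

theorem stageZero_reversible {d : ℕ} (γ : ℝ) (Λ : Finset (Pos d)) (u : Pos d → ℝ) :
    (stageZero γ Λ u).Reversible where
  adm_rev := by
    rintro ⟨x, y⟩ ⟨h1, h2, h3⟩
    refine ⟨h2, h1, h3.imp Eq.symm fun h => ?_⟩
    rw [dist1_comm]; exact h
  supp_rev := by
    rintro ⟨x, y⟩ _
    exact Set.pair_comm _ _
  wt_rev := by
    rintro lam ⟨x, y⟩ _
    exact hamBlock_transpose γ u x y

theorem stage_reversible {d : ℕ} (γ : ℝ) (Λ : Finset (Pos d)) (u : Pos d → ℝ) (E : ℝ) :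
    ∀ k, (stage γ Λ u E k).Reversible
  | 0 => stageZero_reversible γ Λ u
  | k + 1 => (stage_reversible γ Λ u E k).next (stage_regular γ Λ u E k) γ E

/-! ### Linear algebra -/

section LinearAlgebra

variable {n : Type*} [Fintype n] [DecidableEq n]

/-- The Schur test for a symmetric matrix. -/
theorem norm_toEuclideanCLM_le {M : Matrix n n ℝ} (hM : M.transpose = M) {r : ℝ} (hr : 0 ≤ r)
    (h : ∀ i, ∑ j, |M i j| ≤ r) : ‖Matrix.toEuclideanCLM (𝕜 := ℝ) M‖ ≤ r := by
  refine ContinuousLinearMap.opNorm_le_bound _ hr fun v => ?_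
  refine le_of_sq_le_sq ?_ (by positivity)
  rw [mul_pow, EuclideanSpace.real_norm_sq_eq, EuclideanSpace.real_norm_sq_eq]
  have hcol : ∀ j, ∑ i, |M i j| ≤ r := fun j => by
    rw [← hM]; exact h j
  calc ∑ i, (Matrix.toEuclideanCLM (𝕜 := ℝ) M v) i ^ 2
      = ∑ i, (∑ j, M i j * v j) ^ 2 := rfl
    -- Cauchy–Schwarz with the weights `|M i j|`; the column sums needed afterwards equal row sums
    -- by symmetry.
    _ ≤ ∑ i, (∑ j, |M i j|) * ∑ j, |M i j| * v j ^ 2 := by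
        refine Finset.sum_le_sum fun i _ => ?_
        refine Finset.sum_sq_le_sum_mul_sum_of_sq_le_mul _ (fun j _ => abs_nonneg _)
          (fun j _ => by positivity) fun j _ => ?_
        rw [mul_pow, ← sq_abs (M i j)]
        exact le_of_eq (by ring)
    _ ≤ ∑ i, r * ∑ j, |M i j| * v j ^ 2 := by
        refine Finset.sum_le_sum fun i _ => mul_le_mul_of_nonneg_right (h i) ?_
        exact Finset.sum_nonneg fun j _ => by positivity
    _ = r * ∑ j, (∑ i, |M i j|) * v j ^ 2 := by
        rw [← Finset.mul_sum, Finset.sum_comm]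
        simp only [Finset.sum_mul]
    _ ≤ r * ∑ j, r * v j ^ 2 := by
        gcongr with j
        exact hcol j
    _ = r ^ 2 * ∑ j, v j ^ 2 := by rw [← Finset.mul_sum]; ring

/-- A symmetric matrix whose spectrum has distance at least `c` from `E` is bounded below
after a shift by `E`. -/
theorem mul_norm_le_of_spectrum {M : Matrix n n ℝ} (hM : M.transpose = M) {E c : ℝ} (hc : 0 ≤ c)
    (h : ∀ μ ∈ spectrum ℝ M, c ≤ |μ - E|) (v : EuclideanSpace ℝ n) :
    c * ‖v‖ ≤ ‖Matrix.toEuclideanCLM (𝕜 := ℝ) (M - E • 1) v‖ := by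
  have hH : M.IsHermitian := by
    rw [Matrix.IsHermitian, Matrix.conjTranspose_eq_transpose_of_trivial, hM]
  let b := hH.eigenvectorBasis
  have hin : ∀ i, inner ℝ (b i) (Matrix.toEuclideanCLM (𝕜 := ℝ) (M - E • 1) v) =
      (hH.eigenvalues i - E) * inner ℝ (b i) v := fun i => by
    have h1 : Matrix.toEuclideanCLM (𝕜 := ℝ) (M - E • 1) v =
        Matrix.toEuclideanCLM (𝕜 := ℝ) M v - E • v := by
      rw [map_sub, map_smul, map_one]; rfl
    have h2 : inner ℝ (b i) (Matrix.toEuclideanCLM (𝕜 := ℝ) M v) =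
        hH.eigenvalues i * inner ℝ (b i) v := by
      rw [Matrix.inner_toEuclideanCLM, Matrix.dotProduct_mulVec, ← Matrix.mulVec_transpose, hM,
        hH.mulVec_eigenvectorBasis i, smul_dotProduct, smul_eq_mul]
      congr 1
      rw [real_inner_comm]
      rfl
    rw [h1, inner_sub_right, h2, inner_smul_right]
    ring
  refine le_of_sq_le_sq ?_ (norm_nonneg _)
  rw [mul_pow, ← b.sum_sq_norm_inner_right v, ← b.sum_sq_norm_inner_right, Finset.mul_sum]
  refine Finset.sum_le_sum fun i _ => ?_
  rw [hin, norm_mul, mul_pow, Real.norm_eq_abs (hH.eigenvalues i - E)]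
  gcongr
  exact h _ (hH.eigenvalues_mem_spectrum_real i)

theorem isUnit_of_mul_norm_le {A : Matrix n n ℝ} {c : ℝ} (hc : 0 < c)
    (h : ∀ v, c * ‖v‖ ≤ ‖Matrix.toEuclideanCLM (𝕜 := ℝ) A v‖) : IsUnit A := by
  rw [← Matrix.mulVec_injective_iff_isUnit, ← Matrix.coe_mulVecLin,
    ← LinearMap.ker_eq_bot, LinearMap.ker_eq_bot']
  intro v hv
  have h1 := h (WithLp.toLp 2 v)
  have h2 : Matrix.toEuclideanCLM (𝕜 := ℝ) A (WithLp.toLp 2 v) = 0 := by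
    rw [Matrix.toEuclideanCLM_toLp]
    exact congrArg (WithLp.toLp 2) hv
  rw [h2, norm_zero] at h1
  have h3 : WithLp.toLp 2 v = 0 := by
    rw [← norm_le_zero_iff]
    by_contra! hlt
    exact absurd h1 (by positivity : 0 < c * _).not_ge
  exact congrArg WithLp.ofLp h3

theorem norm_inv_le_of_mul_norm_le {A : Matrix n n ℝ} {c : ℝ} (hc : 0 < c)
    (h : ∀ v, c * ‖v‖ ≤ ‖Matrix.toEuclideanCLM (𝕜 := ℝ) A v‖) :
    ‖Matrix.toEuclideanCLM (𝕜 := ℝ) A⁻¹‖ ≤ c⁻¹ := by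
  refine ContinuousLinearMap.opNorm_le_bound _ (by positivity) fun v => ?_
  have hu := (Matrix.isUnit_iff_isUnit_det A).1 (isUnit_of_mul_norm_le hc h)
  have h1 := h (Matrix.toEuclideanCLM (𝕜 := ℝ) A⁻¹ v)
  rw [← mul_apply_eq_comp, ← map_mul, Matrix.mul_nonsing_inv _ hu, map_one,
    one_apply_eq_self] at h1
  rw [inv_mul_eq_div, le_div_iff₀ hc]
  linarith

theorem abs_entry_le (A : Matrix n n ℝ) (i j : n) :
    |A i j| ≤ ‖Matrix.toEuclideanCLM (𝕜 := ℝ) A‖ := by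
  have h1 := (Matrix.toEuclideanCLM (𝕜 := ℝ) A).le_opNorm (EuclideanSpace.single j 1)
  rw [PiLp.norm_single, norm_one, mul_one] at h1
  refine le_trans ?_ h1
  have h2 := PiLp.norm_apply_le (Matrix.toEuclideanCLM (𝕜 := ℝ) A (EuclideanSpace.single j 1)) i
  refine le_trans (le_of_eq ?_) h2
  rw [← Real.norm_eq_abs]
  congr 1
  change _ = A.mulVec (Pi.single j 1) i
  rw [Matrix.mulVec_single_one]
  rfl

/-- The resolvent identity `A⁻¹ - B⁻¹ = A⁻¹ * (B - A) * B⁻¹`. -/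
theorem norm_inv_sub_inv_le {A B : Matrix n n ℝ} {a b s : ℝ} (ha : 0 < a) (hb : 0 < b)
    (hA : ∀ v, a * ‖v‖ ≤ ‖Matrix.toEuclideanCLM (𝕜 := ℝ) A v‖)
    (hB : ∀ v, b * ‖v‖ ≤ ‖Matrix.toEuclideanCLM (𝕜 := ℝ) B v‖)
    (hs : ‖Matrix.toEuclideanCLM (𝕜 := ℝ) (B - A)‖ ≤ s) :
    ‖Matrix.toEuclideanCLM (𝕜 := ℝ) (A⁻¹ - B⁻¹)‖ ≤ a⁻¹ * s * b⁻¹ := by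
  have huA := (Matrix.isUnit_iff_isUnit_det A).1 (isUnit_of_mul_norm_le ha hA)
  have huB := (Matrix.isUnit_iff_isUnit_det B).1 (isUnit_of_mul_norm_le hb hB)
  have h1 : A⁻¹ - B⁻¹ = A⁻¹ * (B - A) * B⁻¹ := by
    rw [mul_sub, sub_mul, mul_assoc, Matrix.mul_nonsing_inv _ huB, mul_one,
      Matrix.nonsing_inv_mul _ huA, one_mul]
  rw [h1, map_mul, map_mul]
  calc _ ≤ ‖Matrix.toEuclideanCLM (𝕜 := ℝ) A⁻¹ * Matrix.toEuclideanCLM (𝕜 := ℝ) (B - A)‖ *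
        ‖Matrix.toEuclideanCLM (𝕜 := ℝ) B⁻¹‖ := norm_mul_le _ _
    _ ≤ ‖Matrix.toEuclideanCLM (𝕜 := ℝ) A⁻¹‖ * ‖Matrix.toEuclideanCLM (𝕜 := ℝ) (B - A)‖ *
        ‖Matrix.toEuclideanCLM (𝕜 := ℝ) B⁻¹‖ := by gcongr; exact norm_mul_le _ _
    _ ≤ _ := by
        gcongr
        · exact mul_nonneg (inv_nonneg.2 ha.le) ((norm_nonneg _).trans hs)
        · exact norm_inv_le_of_mul_norm_le ha hA
        · exact norm_inv_le_of_mul_norm_le hb hB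

end LinearAlgebra

/-! ### Bounds of the weights -/

section Weights

open scoped Matrix.Norms.Operator ENNReal

theorem row_sum_le_norm (A : Matrix (Fin 2) (Fin 2) ℝ) (i : Fin 2) : ∑ j, |A i j| ≤ ‖A‖ := by
  rw [Matrix.linfty_opNorm_def]
  have h := Finset.le_sup (f := fun i => ∑ j, ‖A i j‖₊) (Finset.mem_univ i)
  have h' : ((∑ j, ‖A i j‖₊ : NNReal) : ℝ) ≤ (Finset.univ.sup fun i => ∑ j, ‖A i j‖₊ : NNReal) :=
    by exact_mod_cast h
  refine le_trans (le_of_eq ?_) h'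
  push_cast
  simp [Real.norm_eq_abs]

theorem norm_le_of_row_sum_le {A : Matrix (Fin 2) (Fin 2) ℝ} {r : ℝ} (hr : 0 ≤ r)
    (h : ∀ i, ∑ j, |A i j| ≤ r) : ‖A‖ ≤ r := by
  rw [Matrix.linfty_opNorm_def]
  lift r to NNReal using hr
  refine NNReal.coe_le_coe.2 (Finset.sup_le fun i _ => ?_)
  rw [← NNReal.coe_le_coe]
  refine le_trans (le_of_eq ?_) (h i)
  push_cast
  simp [Real.norm_eq_abs]

theorem norm_le_of_entry_le {A : Matrix (Fin 2) (Fin 2) ℝ} {r : ℝ} (hr : 0 ≤ r)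
    (h : ∀ i j, |A i j| ≤ r) : ‖A‖ ≤ 2 * r :=
  norm_le_of_row_sum_le (by positivity) fun i => by
    rw [Fin.sum_univ_two]
    linarith [h i 0, h i 1]

theorem le_listBudget {G : Type} {κ : ℝ} {S : G → ℝ} : ∀ (l : List G) (g : G),
    (∀ h ∈ g :: l, κ ≤ S h) → κ ≤ listBudget κ S (g :: l)
  | [], g, h => h g (by simp)
  | g' :: l, g, h => by
    have h1 := le_listBudget l g' fun h' hh => h h' (.tail _ hh)
    have h2 := h g (by simp)
    rw [listBudget]
    linarith

/-- Each jump withdraws `γ ^ κ` from the budget; multiplied by the resolvent bound `ρ`, this is at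
most the jump factor `η`. -/
theorem norm_chainWeight_le {G : Type} {γ ρ κ η : ℝ} (hγ : 0 < γ) (hρ : 0 ≤ ρ)
    (hη : ρ * γ ^ κ ≤ η)
    {X S : G → ℝ} {w : G → Matrix (Fin 2) (Fin 2) ℝ}
    {r : G → G → Matrix (Fin 2) (Fin 2) ℝ} (hX : ∀ g, 0 ≤ X g) : ∀ (l : List G) (g : G),
      (∀ h ∈ g :: l, ‖w h‖ ≤ X h * γ ^ S h) →
      (g :: l).IsChain (fun g g' => ‖r g g'‖ ≤ ρ) →
      ‖chainWeight r w (g :: l)‖ ≤ listFactor η X (g :: l) * γ ^ listBudget κ S (g :: l)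
  | [], g, hw, _ => hw g (by simp)
  | g' :: l, g, hw, hr => by
    rw [List.isChain_cons_cons] at hr
    have ih := norm_chainWeight_le hγ hρ hη hX l g' (fun h hh => hw h (.tail _ hh)) hr.2
    have hη0 : 0 ≤ η := le_trans (by positivity) hη
    have hF := listFactor_nonneg hη0 hX (g' :: l)
    have hXg := hX g
    rw [chainWeight, norm_neg, listFactor, listBudget]
    calc _ ≤ ‖w g‖ * ‖r g g'‖ * ‖chainWeight r w (g' :: l)‖ :=
          (norm_mul_le _ _).trans (by gcongr; exact norm_mul_le _ _)
      _ ≤ (X g * γ ^ S g) * ρ *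
          (listFactor η X (g' :: l) * γ ^ listBudget κ S (g' :: l)) := by
          gcongr
          · exact hw g (by simp)
          · exact hr.1
      _ = X g * (ρ * γ ^ κ) * listFactor η X (g' :: l) *
          γ ^ (S g - κ + listBudget κ S (g' :: l)) := by
          rw [Real.rpow_add hγ, Real.rpow_sub hγ]
          have := (Real.rpow_pos_of_pos hγ κ).ne'
          field_simp
      _ ≤ _ := by gcongr

theorem norm_mul_sub_mul_le {A B C A' B' C' : Matrix (Fin 2) (Fin 2) ℝ} :
    ‖A * B * C - A' * B' * C'‖ ≤
      ‖A - A'‖ * ‖B‖ * ‖C‖ + ‖A'‖ * ‖B - B'‖ * ‖C‖ + ‖A'‖ * ‖B'‖ * ‖C - C'‖ := by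
  have : A * B * C - A' * B' * C' =
      (A - A') * B * C + A' * (B - B') * C + A' * B' * (C - C') := by noncomm_ring
  have h3 : ∀ A B C : Matrix (Fin 2) (Fin 2) ℝ, ‖A * B * C‖ ≤ ‖A‖ * ‖B‖ * ‖C‖ :=
    fun A B C => (norm_mul_le _ _).trans (by gcongr; exact norm_mul_le _ _)
  rw [this]
  exact (norm_add₃_le).trans (add_le_add_three (h3 _ _ _) (h3 _ _ _) (h3 _ _ _))

/-- Leibniz rule: one of `l.length + 1` steps or one of `l.length` jumps is changed at a time. A
changed step keeps two thirds of its budget, while a changed jump costs an extra `γ ^ (-c)`. -/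
theorem norm_chainWeight_sub_le {G : Type} {γ ρ κ η c t : ℝ} (hγ : 0 < γ) (hγ1 : γ ≤ 1)
    (hρ : 0 ≤ ρ) (ht : 0 ≤ t) (hη : ρ * γ ^ κ ≤ η)
    {X S : G → ℝ} {w w' : G → Matrix (Fin 2) (Fin 2) ℝ}
    {r r' : G → G → Matrix (Fin 2) (Fin 2) ℝ} (hX : ∀ g, 0 ≤ X g) : ∀ (l : List G) (g : G),
      (∀ h ∈ g :: l, κ ≤ S h ∧ ‖w h‖ ≤ X h * γ ^ S h ∧ ‖w' h‖ ≤ X h * γ ^ S h ∧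
        ‖w h - w' h‖ ≤ t * (X h * γ ^ (2 / 3 * S h))) →
      (g :: l).IsChain (fun g g' => ‖r g g'‖ ≤ ρ ∧ ‖r' g g'‖ ≤ ρ ∧
        ‖r g g' - r' g g'‖ ≤ t * (ρ * γ ^ (-c))) →
      ‖chainWeight r w (g :: l) - chainWeight r' w' (g :: l)‖ ≤
        t * (listFactor η X (g :: l) *
          ((l.length + 1) * γ ^ (2 / 3 * listBudget κ S (g :: l)) +
            l.length * γ ^ (listBudget κ S (g :: l) - c)))
  | [], g, hw, _ => by simpa [chainWeight, listFactor, listBudget] using (hw g (by simp)).2.2.2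
  | g' :: l, g, hw, hr => by
    rw [List.isChain_cons_cons] at hr
    have hw' : ∀ h ∈ g' :: l, _ := fun h hh => hw h (.tail _ hh)
    have ih := norm_chainWeight_sub_le hγ hγ1 hρ ht hη hX l g' hw' hr.2
    have hC := norm_chainWeight_le hγ hρ hη hX l g' (fun h hh => (hw' h hh).2.1)
      (hr.2.imp fun _ _ h => h.1)
    have hB := le_listBudget l g' fun h hh => (hw' h hh).1
    obtain ⟨hS, hw1, hw2, hw3⟩ := hw g (by simp)
    obtain ⟨hr1, hr2, hr3⟩ := hr.1
    have hη0 : 0 ≤ η := le_trans (by positivity) hη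
    have hF := listFactor_nonneg hη0 hX (g' :: l)
    have hXg := hX g
    set F := listFactor η X (g' :: l) with hFdef
    set b := listBudget κ S (g' :: l) with hbdef
    have hκ := (Real.rpow_pos_of_pos hγ κ).ne'
    have hm : (0 : ℝ) ≤ l.length := Nat.cast_nonneg _
    -- The unchanged part keeps its full budget, which is at least `κ` because every step pays for a
    -- jump. Hence the whole of `κ` can be withdrawn while the total is kept at rate `2/3`.
    have e1 : γ ^ (2 / 3 * S g + b) ≤ γ ^ (κ + 2 / 3 * (S g - κ + b)) :=
      Real.rpow_le_rpow_of_exponent_ge hγ hγ1 (by linarith)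
    have e2 : γ ^ (S g + 2 / 3 * b) ≤ γ ^ (κ + 2 / 3 * (S g - κ + b)) :=
      Real.rpow_le_rpow_of_exponent_ge hγ hγ1 (by linarith)
    rw [Real.rpow_add hγ, Real.rpow_add hγ κ] at e1 e2
    have e3 : γ ^ S g * γ ^ (-c) * γ ^ b = γ ^ κ * γ ^ (S g - κ + b - c) := by
      rw [← Real.rpow_add hγ, ← Real.rpow_add hγ, ← Real.rpow_add hγ]; ring_nf
    have e4 : γ ^ S g * γ ^ (b - c) = γ ^ κ * γ ^ (S g - κ + b - c) := by
      rw [← Real.rpow_add hγ, ← Real.rpow_add hγ]; ring_nf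
    rw [chainWeight, chainWeight, neg_sub_neg, norm_sub_rev, listFactor, listBudget, ← hFdef,
      ← hbdef]
    refine norm_mul_sub_mul_le.trans ?_
    have hη' : X g * (ρ * γ ^ κ) * F ≤ X g * η * F := by gcongr
    set P := γ ^ (2 / 3 * (S g - κ + b)) with hP
    set Q := γ ^ (S g - κ + b - c) with hQ
    have hP0 : 0 < P := Real.rpow_pos_of_pos hγ _
    have hQ0 : 0 < Q := Real.rpow_pos_of_pos hγ _
    calc _ ≤ t * (X g * γ ^ (2 / 3 * S g)) * ρ * (F * γ ^ b) +
          (X g * γ ^ S g) * (t * (ρ * γ ^ (-c))) * (F * γ ^ b) +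
          (X g * γ ^ S g) * ρ * (t * (F * ((l.length + 1) * γ ^ (2 / 3 * b) +
            l.length * γ ^ (b - c)))) := by
          gcongr
      _ = t * (X g * ρ * F * (γ ^ (2 / 3 * S g) * γ ^ b + γ ^ S g * γ ^ (-c) * γ ^ b +
          ((l.length + 1) * (γ ^ S g * γ ^ (2 / 3 * b)) +
            l.length * (γ ^ S g * γ ^ (b - c))))) := by ring
      _ ≤ t * (X g * ρ * F * (γ ^ κ * P + γ ^ κ * Q +
          ((l.length + 1) * (γ ^ κ * P) + l.length * (γ ^ κ * Q)))) := by
          rw [e3, e4]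
          gcongr
      _ = t * (X g * (ρ * γ ^ κ) * F * ((l.length + 1 + 1) * P + (l.length + 1) * Q)) := by ring
      _ ≤ t * (X g * η * F * ((l.length + 1 + 1) * P + (l.length + 1) * Q)) := by gcongr
      _ = _ := by push_cast [List.length_cons]; ring

theorem listFactor_mul_pow {G : Type} (η a : ℝ) (X : G → ℝ) : ∀ (l : List G) (g : G),
    listFactor (a * η) X (g :: l) = listFactor η X (g :: l) * a ^ l.length
  | [], g => by simp [listFactor]
  | g' :: l, g => by
    rw [listFactor, listFactor_mul_pow η a X l g', listFactor, List.length_cons, pow_succ]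
    ring

/-! ### The induction -/

namespace Stage

variable {d k : ℕ}

/-- The bounds of the weights of multigraphs at the energies `lam` and `E`. -/
structure Bounded (S : Stage d k) (γ lam E : ℝ) : Prop where
  wt_le : ∀ μ ∈ ({lam, E} : Set ℝ), ∀ g, S.adm g →
    ‖S.wt μ g‖ ≤ g.factor γ k * γ ^ g.budget k
  sub_le : ∀ g, S.adm g →
    ‖S.wt lam g - S.wt E g‖ ≤ |lam - E| * (g.factor γ k * γ ^ (2 / 3 * g.budget k))
  eq_or_le : ∀ g, S.adm g → S.wt lam g = S.wt E g ∨ 9 / 8 ≤ g.budget k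

variable {S : Stage d k} {γ lam E : ℝ}

/-- The source of `γ/ε`: a multigraph either has the same weight at both energies or retains at
least `2/3 * 9/8 = 3/4` as exponent. -/
theorem Bounded.sub_le_rpow (hS : S.Bounded γ lam E) (hγ : 0 < γ) (hγ1 : γ ≤ 1)
    {g : Multigraph d k} (hg : S.adm g) :
    ‖S.wt lam g - S.wt E g‖ ≤ |lam - E| * γ ^ (3 / 4 : ℝ) * g.factor γ k := by
  have hX := Multigraph.factor_nonneg hγ.le k g
  rcases hS.eq_or_le g hg with h | h
  · rw [h, sub_self, norm_zero]
    positivity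
  · refine (hS.sub_le g hg).trans ?_
    rw [mul_assoc, mul_comm (γ ^ (3 / 4 : ℝ))]
    gcongr ?_ * (?_ * ?_)
    exact Real.rpow_le_rpow_of_exponent_ge hγ hγ1 (by linarith)

theorem Regular.budget_nonneg (hR : S.Regular) {g : Multigraph d k} (hg : S.adm g) :
    0 ≤ g.budget k := by
  obtain ⟨D, hD, hp, _⟩ := hR.extent g hg
  rw [← hp]
  exact pot_nonneg hD

/-- The sum of the factors of the multigraphs local to a block, over all end points. -/
theorem sum_factor_local_le (S : Stage d k) (γ : ℝ) (B : Finset (Pos d)) (x : Pos d) :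
    ∑ y : ↥B, ∑' g : S.LocalGraph B x y, ENNReal.ofReal (g.1.factor γ k) ≤
      S.factorSum γ x := by
  classical
  rw [← tsum_fintype (L := .unconditional _),
    ← ENNReal.tsum_sigma (f := fun (y : ↥B) (g : S.LocalGraph B x y) =>
      ENNReal.ofReal (g.1.factor γ k))]
  let f : (Σ y : ↥B, S.LocalGraph B x y) → Multigraph d k := fun p => p.2.1
  have hf : Function.Injective f := by
    rintro ⟨y, g⟩ ⟨y', g'⟩ h
    have h1 : g.1 = g'.1 := h
    have h2 : y = y' := Subtype.ext (by rw [← g.2.2.2.2, ← g'.2.2.2.2, h1])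
    subst h2
    congr 1
    exact Subtype.ext h1
  refine le_trans (le_of_eq ?_) (ENNReal.tsum_comp_le_tsum_of_injective hf _)
  refine tsum_congr fun p => ?_
  rw [if_pos ⟨p.2.2.1, p.2.2.2.2.1⟩]

theorem abs_entry_le_norm (A : Matrix (Fin 2) (Fin 2) ℝ) (i j : Fin 2) : |A i j| ≤ ‖A‖ :=
  (Finset.single_le_sum (f := fun j => |A i j|) (fun _ _ => abs_nonneg _)
    (Finset.mem_univ j)).trans (row_sum_le_norm A i)

theorem Bounded.summable (hS : S.Bounded γ lam E) (hR : S.Regular) (hγ : 0 < γ) (hγ1 : γ ≤ 1)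
    (hsum : ∀ x, S.factorSum γ x ≤ ENNReal.ofReal 4) {μ : ℝ} (hμ : μ ∈ ({lam, E} : Set ℝ))
    (B : Finset (Pos d)) (p q : ↥B × Fin 2) :
    Summable fun g : S.LocalGraph B p.1 q.1 => S.wt μ g.1 p.2 q.2 := by
  rw [← summable_norm_iff, ← tsum_enorm_ne_top_iff_summable_norm]
  refine ne_top_of_le_ne_top (ENNReal.ofReal_ne_top (r := 4)) (le_trans ?_ (hsum p.1))
  refine le_trans ?_ (S.sum_factor_local_le γ B p.1)
  refine le_trans ?_ (Finset.single_le_sum (f := fun y : ↥B =>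
    ∑' g : S.LocalGraph B p.1 y, ENNReal.ofReal (g.1.factor γ k)) (fun _ _ => zero_le)
    (Finset.mem_univ q.1))
  refine ENNReal.tsum_le_tsum fun g => ?_
  rw [Real.enorm_eq_ofReal_abs]
  refine ENNReal.ofReal_le_ofReal ?_
  have hX := Multigraph.factor_nonneg hγ.le k g.1
  calc |S.wt μ g.1 p.2 q.2| ≤ ‖S.wt μ g.1‖ := abs_entry_le_norm _ _ _
    _ ≤ g.1.factor γ k * γ ^ g.1.budget k := hS.wt_le μ hμ _ g.2.1
    _ ≤ g.1.factor γ k * 1 := by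
        gcongr
        exact Real.rpow_le_one hγ.le hγ1 (hR.budget_nonneg g.2.1)
    _ = _ := mul_one _

theorem Bounded.norm_Ftilde_sub_le (hS : S.Bounded γ lam E) (hR : S.Regular)
    (hrev : S.Reversible) (hγ : 0 < γ) (hγ1 : γ ≤ 1)
    (hsum : ∀ x, S.factorSum γ x ≤ ENNReal.ofReal 4) (B : Finset (Pos d)) :
    ‖Matrix.toEuclideanCLM (𝕜 := ℝ) (S.Ftilde lam B - S.Ftilde E B)‖ ≤
      4 * γ ^ (3 / 4 : ℝ) * |lam - E| := by
  refine norm_toEuclideanCLM_le ?_ (by positivity) fun p => ?_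
  · rw [Matrix.transpose_sub, hrev.Ftilde_transpose, hrev.Ftilde_transpose]
  -- A divergent `tsum` has the value 0, so the termwise difference relies on summability at both
  -- energies.
  have hent : ∀ q, (S.Ftilde lam B - S.Ftilde E B) p q =
      ∑' g : S.LocalGraph B p.1 q.1, (S.wt lam g.1 - S.wt E g.1) p.2 q.2 := fun q =>
    ((hS.summable hR hγ hγ1 hsum (by simp) B p q).tsum_sub
      (hS.summable hR hγ hγ1 hsum (by simp) B p q)).symm
  rw [← ENNReal.ofReal_le_ofReal_iff (by positivity),
    ENNReal.ofReal_sum_of_nonneg fun _ _ => abs_nonneg _]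
  calc ∑ q, ENNReal.ofReal |(S.Ftilde lam B - S.Ftilde E B) p q|
      ≤ ∑ q : ↥B × Fin 2, ∑' g : S.LocalGraph B p.1 q.1,
          ENNReal.ofReal |(S.wt lam g.1 - S.wt E g.1) p.2 q.2| := by
        refine Finset.sum_le_sum fun q _ => ?_
        rw [hent, ← Real.enorm_eq_ofReal_abs]
        refine enorm_tsum_le_tsum_enorm.trans (le_of_eq ?_)
        simp only [Real.enorm_eq_ofReal_abs]
    _ = ∑ y : ↥B, ∑' g : S.LocalGraph B p.1 y,
          ∑ j, ENNReal.ofReal |(S.wt lam g.1 - S.wt E g.1) p.2 j| := by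
        rw [Fintype.sum_prod_type]
        refine Finset.sum_congr rfl fun y _ => ?_
        exact (Summable.tsum_finsetSum
          (f := fun j (g : S.LocalGraph B p.1 y) =>
            ENNReal.ofReal |(S.wt lam g.1 - S.wt E g.1) p.2 j|)
          fun _ _ => ENNReal.summable).symm
    _ ≤ ∑ y : ↥B, ∑' g : S.LocalGraph B p.1 y,
          ENNReal.ofReal (|lam - E| * γ ^ (3 / 4 : ℝ)) * ENNReal.ofReal (g.1.factor γ k) := by
        refine Finset.sum_le_sum fun y _ => ENNReal.tsum_le_tsum fun g => ?_
        rw [← ENNReal.ofReal_sum_of_nonneg fun _ _ => abs_nonneg _,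
          ← ENNReal.ofReal_mul (by positivity)]
        exact ENNReal.ofReal_le_ofReal
          ((row_sum_le_norm _ _).trans (hS.sub_le_rpow hγ hγ1 g.2.1))
    _ ≤ ENNReal.ofReal (|lam - E| * γ ^ (3 / 4 : ℝ)) * ENNReal.ofReal 4 := by
        simp only [ENNReal.tsum_mul_left, ← Finset.mul_sum]
        gcongr
        exact (S.sum_factor_local_le γ B p.1).trans (hsum _)
    _ = _ := by
        rw [← ENNReal.ofReal_mul (by positivity)]
        ring_nf

/-- Lower bounds of `F̃ - μ` on removed blocks, at `E` and at `lam`. -/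
theorem Bounded.mul_norm_le (hS : S.Bounded γ lam E) (hR : S.Regular)
    (hrev : S.Reversible) (hγ : 0 < γ) (hγ1 : γ ≤ 1) (hγ2 : γ ^ (3 / 4 : ℝ) ≤ 1 / 8)
    (hsum : ∀ x, S.factorSum γ x ≤ ENNReal.ofReal 4)
    (hlam : |lam - E| ≤ epsk γ (k + 1) / 2) {x : Pos d} (hx : x ∈ S.R \ S.nextR γ E) :
    (∀ v, epsk γ (k + 1) * ‖v‖ ≤ ‖Matrix.toEuclideanCLM (n := ↥(S.block x) × Fin 2) (𝕜 := ℝ)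
      (S.Ftilde E (S.block x) - E • 1) v‖) ∧
    (∀ v, epsk γ (k + 1) / 4 * ‖v‖ ≤ ‖Matrix.toEuclideanCLM (n := ↥(S.block x) × Fin 2) (𝕜 := ℝ)
      (S.Ftilde lam (S.block x) - lam • 1) v‖) ∧
    ‖Matrix.toEuclideanCLM (n := ↥(S.block x) × Fin 2) (𝕜 := ℝ) ((S.Ftilde E (S.block x) - E • 1) -
      (S.Ftilde lam (S.block x) - lam • 1))‖ ≤ 3 / 2 * |lam - E| := by
  set B := S.block x
  have hε : 0 < epsk γ (k + 1) := by rw [epsk_succ hγ]; positivity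
  obtain ⟨hxR, hiso, hres⟩ := mem_sdiff_nextR_iff.1 hx
  have h1 : ∀ v, epsk γ (k + 1) * ‖v‖ ≤ ‖Matrix.toEuclideanCLM (n := ↥B × Fin 2) (𝕜 := ℝ)
      (S.Ftilde E B - E • 1) v‖ :=
    mul_norm_le_of_spectrum (hrev.Ftilde_transpose E B) hε.le fun μ hμ => by
      by_contra! hlt
      exact hres ⟨hiso, μ, hμ, hlt.le⟩
  have h2 : ‖Matrix.toEuclideanCLM (n := ↥B × Fin 2) (𝕜 := ℝ) ((S.Ftilde E B - E • 1) -
      (S.Ftilde lam B - lam • 1))‖ ≤ 3 / 2 * |lam - E| := by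
    have h3 := hS.norm_Ftilde_sub_le hR hrev hγ hγ1 hsum B
    have h4 : (S.Ftilde E B - E • 1) - (S.Ftilde lam B - lam • 1) =
        (lam - E) • (1 : Matrix (↥B × Fin 2) (↥B × Fin 2) ℝ) -
          (S.Ftilde lam B - S.Ftilde E B) := by
      rw [sub_smul]; abel
    rw [h4, map_sub, map_smul, map_one]
    have h5 : ‖(lam - E) • (1 : EuclideanSpace ℝ (↥B × Fin 2) →L[ℝ]
        EuclideanSpace ℝ (↥B × Fin 2))‖ ≤ |lam - E| := by
      rw [norm_smul, Real.norm_eq_abs]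
      exact mul_le_of_le_one_right (abs_nonneg _) ContinuousLinearMap.norm_id_le
    refine (norm_sub_le _ _).trans ?_
    have h6 : 4 * γ ^ (3 / 4 : ℝ) * |lam - E| ≤ 1 / 2 * |lam - E| := by gcongr; linarith
    linarith
  refine ⟨h1, fun v => ?_, h2⟩
  have h7 := (Matrix.toEuclideanCLM (n := ↥B × Fin 2) (𝕜 := ℝ) ((S.Ftilde E B - E • 1) -
      (S.Ftilde lam B - lam • 1))).le_opNorm v
  rw [map_sub, sub_apply] at h7
  have h8 := norm_sub_norm_le (Matrix.toEuclideanCLM (n := ↥B × Fin 2) (𝕜 := ℝ) (S.Ftilde E B - E • 1) v)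
    (Matrix.toEuclideanCLM (n := ↥B × Fin 2) (𝕜 := ℝ) (S.Ftilde lam B - lam • 1) v)
  rw [map_sub] at h2
  -- In the window `|lam - E| ≤ ε_{k+1}/2` the perturbation is at most three quarters of the gap at
  -- `E`, which leaves one quarter.
  have h9 := mul_le_mul_of_nonneg_right (h2.trans
    (by linarith : 3 / 2 * |lam - E| ≤ 3 / 4 * epsk γ (k + 1))) (norm_nonneg v)
  have := h1 v
  linarith

/-- Entries of a matrix are bounded by its operator norm, and passing to `2 × 2` blocks costs a
factor 2. This gives 8 for the resolvents and 12 for their difference; 48 covers both. -/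
theorem resolvent_bounds (hγ : 0 < γ) {B : Finset (Pos d)} {s : ℝ}
    (hE : ∀ v, γ ^ s * ‖v‖ ≤ ‖Matrix.toEuclideanCLM (n := ↥B × Fin 2) (𝕜 := ℝ) (S.Ftilde E B - E • 1) v‖)
    (hlam : ∀ v, γ ^ s / 4 * ‖v‖ ≤
      ‖Matrix.toEuclideanCLM (n := ↥B × Fin 2) (𝕜 := ℝ) (S.Ftilde lam B - lam • 1) v‖)
    (hsub : ‖Matrix.toEuclideanCLM (n := ↥B × Fin 2) (𝕜 := ℝ) ((S.Ftilde E B - E • 1) -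
      (S.Ftilde lam B - lam • 1))‖ ≤ 3 / 2 * |lam - E|) (x y : Pos d) :
    (∀ μ ∈ ({lam, E} : Set ℝ), ‖S.resolvent μ B x y‖ ≤ 48 * γ ^ (-s)) ∧
      ‖S.resolvent lam B x y - S.resolvent E B x y‖ ≤
        |lam - E| * (48 * γ ^ (-s) * γ ^ (-s)) := by
  have hs : 0 < γ ^ s := Real.rpow_pos_of_pos hγ s
  rw [Real.rpow_neg hγ.le]
  have hi : 0 < (γ ^ s)⁻¹ := inv_pos.2 hs
  have hi4 : (γ ^ s / 4)⁻¹ = 4 * (γ ^ s)⁻¹ := by rw [inv_div]; rfl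
  have h1 := norm_inv_le_of_mul_norm_le hs hE
  have h2 := norm_inv_le_of_mul_norm_le (by positivity) hlam
  have h3 := norm_inv_sub_inv_le (by positivity) hs hlam hE hsub
  rw [hi4] at h2 h3
  have key : ∀ {μ : ℝ}, ‖Matrix.toEuclideanCLM (n := ↥B × Fin 2) (𝕜 := ℝ) (S.Ftilde μ B - μ • 1)⁻¹‖ ≤
      4 * (γ ^ s)⁻¹ → ‖S.resolvent μ B x y‖ ≤ 48 * (γ ^ s)⁻¹ := fun {μ} h => by
    refine (norm_le_of_entry_le (r := 4 * (γ ^ s)⁻¹) (by positivity) fun i j => ?_).trans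
      (by linarith)
    simp only [resolvent, Matrix.of_apply]
    split_ifs with hxy
    · exact (abs_entry_le _ _ _).trans h
    · rw [abs_zero]; positivity
  refine ⟨?_, ?_⟩
  · rintro μ (rfl | rfl)
    · exact key h2
    · exact key (h1.trans (by linarith))
  · refine (norm_le_of_entry_le (r := 4 * (γ ^ s)⁻¹ * (3 / 2 * |lam - E|) * (γ ^ s)⁻¹)
      (by positivity) fun i j => ?_).trans ?_
    · rw [Matrix.sub_apply]
      simp only [resolvent, Matrix.of_apply]
      split_ifs with hxy
      · refine le_trans ?_ h3
        exact abs_entry_le ((S.Ftilde lam B - lam • 1)⁻¹ - (S.Ftilde E B - E • 1)⁻¹) _ _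
      · rw [sub_self, abs_zero]; positivity
    · have : 0 ≤ |lam - E| * ((γ ^ s)⁻¹ * (γ ^ s)⁻¹) := by positivity
      nlinarith

/-- The bounds of the weights carry over to the next stage. -/
theorem Bounded.next (hS : S.Bounded γ lam E) (hR : S.Regular)
    (hrev : S.Reversible) (hγ : 0 < γ) (hγ1 : γ ≤ 1) (hγ2 : γ ^ (3 / 4 : ℝ) ≤ 1 / 8)
    (hsum : ∀ x, S.factorSum γ x ≤ ENNReal.ofReal 4)
    (hlam : |lam - E| ≤ epsk γ (k + 1) / 2) : (S.next γ E).Bounded γ lam E := by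
  set c := scaleExp k / 4 with hc
  set ρ := 48 * γ ^ (-c) with hρ
  have hρ0 : 0 ≤ ρ := by positivity
  -- The excess exponent is `7/25 - 1/4 = 3/100`.
  have hη : ρ * γ ^ jumpCost k = 48 * γ ^ (3 / 100 * scaleExp k) := by
    rw [hρ, mul_assoc, ← Real.rpow_add hγ, hc, jumpCost]
    ring_nf
  have hr : ∀ {g g' : Multigraph d k}, S.Linked γ E g g' →
      (∀ μ ∈ ({lam, E} : Set ℝ), ‖S.resolvent μ (S.block g.tgt) g.tgt g'.src‖ ≤ ρ) ∧
      ‖S.resolvent lam (S.block g.tgt) g.tgt g'.src -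
        S.resolvent E (S.block g.tgt) g.tgt g'.src‖ ≤ |lam - E| * (ρ * γ ^ (-c)) :=
    fun {g g'} h => by
      obtain ⟨h1, h2, h3⟩ := hS.mul_norm_le hR hrev hγ hγ1 hγ2 hsum hlam h.1
      rw [epsk_succ hγ] at h1 h2
      exact resolvent_bounds hγ h1 h2 h3 _ _
  have hX := Multigraph.factor_nonneg (d := d) hγ.le k
  have key : ∀ w : Walk (Multigraph d k), S.nextAdm γ E w →
      (∀ μ ∈ ({lam, E} : Set ℝ), ‖S.nextWt μ w‖ ≤
        Multigraph.factor γ (k + 1) w * γ ^ Multigraph.budget (k + 1) w) ∧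
      ‖S.nextWt lam w - S.nextWt E w‖ ≤ |lam - E| * (Multigraph.factor γ (k + 1) w *
        γ ^ (2 / 3 * Multigraph.budget (k + 1) w)) ∧
      (S.nextWt lam w = S.nextWt E w ∨ 9 / 8 ≤ Multigraph.budget (k + 1) w) := by
    rintro (g | ⟨b, vs, c'⟩) h
    · have hg : S.adm g := h.1 g (by simp [Walk.steps])
      exact ⟨fun μ hμ => hS.wt_le μ hμ g hg, hS.sub_le g hg, hS.eq_or_le g hg⟩
    obtain ⟨h1, -, -, h4, -⟩ := nextAdm_through h
    obtain ⟨D, hD2, hDL, hDp, -⟩ := hR.extent_through h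
    have hbud : 9 / 8 ≤ Multigraph.budget (d := d) (k + 1) (.through b vs c') := by
      rw [← hDp]
      exact le_pot_two.trans (pot_mono (by norm_num) hD2)
    -- `3/4 * L^ψ` is three times `c = L^ψ/4`, so the loss of `c` leaves at least two thirds of the
    -- budget.
    have hbudc : 3 * c ≤ Multigraph.budget (d := d) (k + 1) (.through b vs c') := by
      rw [← hDp]
      refine le_trans (le_of_eq ?_) (le_pot_of_le (L_pos _).le hDL)
      rw [hc, scaleExp]; ring
    set b' := Multigraph.budget (d := d) (k + 1) (.through b vs c') with hb'
    have hb'' : b' = listBudget (jumpCost k) (Multigraph.budget k) (b :: (vs ++ [c'])) := rfl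
    -- `144 = 3 * 48`: the spare factor 3 per jump is kept to pay for the Leibniz sum.
    have hfac : Multigraph.factor (d := d) γ (k + 1) (.through b vs c') =
        listFactor (48 * γ ^ (3 / 100 * scaleExp k)) (Multigraph.factor γ k)
          (b :: (vs ++ [c'])) * 3 ^ (vs ++ [c']).length := by
      rw [← listFactor_mul_pow]
      change listFactor (jumpFactor γ k) _ _ = _
      rw [jumpFactor]
      ring_nf
      rfl
    have hF0 := listFactor_nonneg (η := 48 * γ ^ (3 / 100 * scaleExp k)) (by positivity) hX
      (b :: (vs ++ [c']))
    refine ⟨fun μ hμ => ?_, ?_, .inr hbud⟩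
    · have h5 := norm_chainWeight_le hγ hρ0 hη.le hX (w := S.wt μ)
        (r := fun g g' => S.resolvent μ (S.block g.tgt) g.tgt g'.src) _ b
        (fun g hg => hS.wt_le μ hμ g (h1 g hg).1) (h4.imp fun g g' h => (hr h).1 μ hμ)
      refine h5.trans ?_
      rw [hfac, ← hb'']
      gcongr
      exact le_mul_of_one_le_right hF0 (one_le_pow₀ (by norm_num))
    · have h5 := norm_chainWeight_sub_le hγ hγ1 hρ0 (abs_nonneg (lam - E)) hη.le hX
        (w := S.wt lam) (w' := S.wt E)
        (r := fun g g' => S.resolvent lam (S.block g.tgt) g.tgt g'.src)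
        (r' := fun g g' => S.resolvent E (S.block g.tgt) g.tgt g'.src) (c := c) _ b
        (fun g hg => ⟨hR.jumpCost_le_budget (h1 g hg).1 (h1 g hg).2,
          hS.wt_le lam (by simp) g (h1 g hg).1, hS.wt_le E (by simp) g (h1 g hg).1,
          hS.sub_le g (h1 g hg).1⟩)
        (h4.imp fun g g' h => ⟨(hr h).1 lam (by simp), (hr h).1 E (by simp), (hr h).2⟩)
      refine h5.trans ?_
      rw [hfac, ← hb'', mul_assoc]
      have h6 : γ ^ (b' - c) ≤ γ ^ (2 / 3 * b') :=
        Real.rpow_le_rpow_of_exponent_ge hγ hγ1 (by linarith)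
      -- With `m` jumps the Leibniz rule has `(m + 1) + m` terms, and `1 + 2 * m ≤ 3 ^ m`.
      have h7 : 1 + ((vs ++ [c']).length : ℝ) * 2 ≤ (1 + 2) ^ (vs ++ [c']).length :=
        one_add_mul_le_pow (by norm_num) _
      norm_num at h7
      have h8 : 0 < γ ^ (2 / 3 * b') := Real.rpow_pos_of_pos hγ _
      refine mul_le_mul_of_nonneg_left (mul_le_mul_of_nonneg_left ?_ hF0) (abs_nonneg _)
      have hm : (0 : ℝ) ≤ (vs ++ [c']).length := Nat.cast_nonneg _
      calc _ ≤ (((vs ++ [c']).length : ℝ) + 1) * γ ^ (2 / 3 * b') +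
            (vs ++ [c']).length * γ ^ (2 / 3 * b') := by gcongr
        _ = (1 + ((vs ++ [c']).length : ℝ) * 2) * γ ^ (2 / 3 * b') := by ring
        _ ≤ _ := by
            gcongr
            simpa using h7
  exact ⟨fun μ hμ w hw => (key w hw).1 μ hμ, fun w hw => (key w hw).2.1,
    fun w hw => (key w hw).2.2⟩

end Stage

/-! ### Start of the induction and choice of the coupling -/

theorem stageZero_bounded {d : ℕ} {γ : ℝ} (hγ : 0 < γ) {Λ : Finset (Pos d)} {u : Pos d → ℝ}
    (hu : ∀ x ∈ Λ, |u x| ≤ 1) (lam E : ℝ) : (stageZero γ Λ u).Bounded γ lam E where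
  wt_le := by
    rintro μ _ ⟨x, y⟩ ⟨hx, hy, hxy⟩
    change ‖hamBlock γ u x y‖ ≤ _
    by_cases h : x = y
    · subst h
      simp only [Multigraph.factor, Multigraph.budget, if_true, Real.rpow_zero, mul_one]
      refine norm_le_of_row_sum_le (by norm_num) fun i => ?_
      have := hu x hx
      rw [Fin.sum_univ_two]
      fin_cases i <;> simp [hamBlock] <;> linarith
    · have h1 : dist1 x y = 1 := hxy.resolve_left h
      simp only [Multigraph.factor, Multigraph.budget, h, if_false]
      rw [← Real.rpow_add hγ]
      norm_num
      refine norm_le_of_row_sum_le hγ.le fun i => ?_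
      rw [Fin.sum_univ_two]
      fin_cases i <;> simp [hamBlock, h, h1, abs_of_pos hγ]
  sub_le := by
    rintro ⟨x, y⟩ _
    change ‖hamBlock γ u x y - hamBlock γ u x y‖ ≤ _
    rw [sub_self, norm_zero]
    have := Multigraph.factor_nonneg hγ.le 0 (x, y)
    positivity
  eq_or_le _ _ := .inl rfl

/-- The energy windows shrink with the level, so the window of the last level is admissible at all
earlier ones. -/
theorem epsk_succ_antitone {γ : ℝ} (hγ : 0 < γ) (hγ1 : γ ≤ 1) {i j : ℕ} (h : i ≤ j) :
    epsk γ (j + 1) ≤ epsk γ (i + 1) := by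
  rw [epsk_succ hγ, epsk_succ hγ]
  exact Real.rpow_le_rpow_of_exponent_ge hγ hγ1 (by linarith [scaleExp_mono h])

/-- The conditions on the size of `γ`. -/
structure SmallCoupling (d : ℕ) (γ : ℝ) : Prop where
  pos : 0 < γ
  le_one : γ ≤ 1
  count : 3 ^ d * γ ^ (1 / 4 : ℝ) ≤ 1 / 4
  jump : γ ^ (3 / 100 : ℝ) ≤ 2⁻¹ ^ 14

theorem SmallCoupling.rpow_le {d : ℕ} {γ : ℝ} (h : SmallCoupling d γ) :
    γ ^ (3 / 4 : ℝ) ≤ 1 / 8 :=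
  calc γ ^ (3 / 4 : ℝ) ≤ γ ^ (3 / 100 : ℝ) :=
        Real.rpow_le_rpow_of_exponent_ge h.pos h.le_one (by norm_num)
    _ ≤ 2⁻¹ ^ 14 := h.jump
    _ ≤ 1 / 8 := by norm_num

theorem exists_smallCoupling (d : ℕ) :
    ∃ γ₀ : ℝ, 0 < γ₀ ∧ ∀ γ, 0 < γ → γ ≤ γ₀ → SmallCoupling d γ := by
  refine ⟨min 1 (min ((1 / 4 / 3 ^ d) ^ (4 : ℝ)) ((2⁻¹ ^ 14) ^ (100 / 3 : ℝ))),
    by positivity, fun γ hγ h => ?_⟩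
  rw [le_min_iff, le_min_iff] at h
  obtain ⟨h1, h2, h3⟩ := h
  refine ⟨hγ, h1, ?_, ?_⟩
  · have := Real.rpow_le_rpow hγ.le h2 (by norm_num : (0 : ℝ) ≤ 1 / 4)
    rw [← Real.rpow_mul (by positivity), show (4 : ℝ) * (1 / 4) = 1 by norm_num,
      Real.rpow_one, le_div_iff₀ (by positivity)] at this
    linarith
  · have := Real.rpow_le_rpow hγ.le h3 (by norm_num : (0 : ℝ) ≤ 3 / 100)
    rwa [← Real.rpow_mul (by positivity), show (100 / 3 : ℝ) * (3 / 100) = 1 by norm_num,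
      Real.rpow_one] at this

theorem SmallCoupling.factorSum_le {d : ℕ} {γ : ℝ} (h : SmallCoupling d γ)
    (Λ : Finset (Pos d)) (u : Pos d → ℝ) (E : ℝ) (k : ℕ) (x : Pos d) :
    (stage γ Λ u E k).factorSum γ x ≤ ENNReal.ofReal 4 := by
  refine (stage_factorSum_le h.pos h.count h.jump Λ u E k x).trans (ENNReal.ofReal_le_ofReal ?_)
  have : (0 : ℝ) < (1 / 2) ^ k := by positivity
  linarith

theorem SmallCoupling.stage_bounded {d : ℕ} {γ : ℝ} (h : SmallCoupling d γ)
    {Λ : Finset (Pos d)} {u : Pos d → ℝ} (hu : ∀ x ∈ Λ, |u x| ≤ 1) {lam E : ℝ} {k : ℕ}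
    (hlam : |lam - E| ≤ epsk γ (k + 1) / 2) :
    ∀ j ≤ k + 1, (stage γ Λ u E j).Bounded γ lam E
  | 0, _ => stageZero_bounded h.pos hu lam E
  | j + 1, hj => by
    refine (h.stage_bounded hu hlam j (by omega)).next (stage_regular γ Λ u E j)
      (stage_reversible γ Λ u E j) h.pos h.le_one h.rpow_le (h.factorSum_le Λ u E j) ?_
    have := epsk_succ_antitone h.pos h.le_one (by omega : j ≤ k)
    linarith

theorem rpow_eq_div_eps {γ : ℝ} (hγ : 0 < γ) : γ ^ (3 / 4 : ℝ) = γ / eps γ := by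
  rw [eps, show (3 / 4 : ℝ) = 1 - 1 / 4 by norm_num, Real.rpow_sub hγ, Real.rpow_one]

end Weights

end BlockAnderson

/-! ### Conclusion -/

theorem mainTheorem11 (d : ℕ) :
    ∃ c γ₀ : ℝ, 0 < c ∧ 0 < γ₀ ∧
      ∀ γ : ℝ, 0 < γ → γ ≤ γ₀ →
      ∀ (a b : BlockAnderson.Pos d) (u : BlockAnderson.Pos d → ℝ),
        (∀ x ∈ Finset.Icc a b, |u x| ≤ 1) →
      ∀ (E lam : ℝ) (k : ℕ), 1 ≤ k → |lam - E| ≤ BlockAnderson.epsk γ k / 2 →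
        -- all block inverses that enter the multigraph expansion exist, at `lam` and at `E`
        (∀ j < k, ∀ B ∈ (BlockAnderson.stage γ (Finset.Icc a b) u E j).blocks,
          Disjoint B (BlockAnderson.stage γ (Finset.Icc a b) u E (j + 1)).R →
          ∀ μ ∈ ({lam, E} : Set ℝ),
            IsUnit ((BlockAnderson.stage γ (Finset.Icc a b) u E j).Ftilde μ B -
              μ • (1 : Matrix (↥B × Fin 2) (↥B × Fin 2) ℝ))) ∧
        ∀ B ∈ (BlockAnderson.stage γ (Finset.Icc a b) u E k).blocks,
          -- the multigraph sums that define the two matrices converge absolutely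
          (∀ μ ∈ ({lam, E} : Set ℝ), ∀ p q : ↥B × Fin 2,
            Summable fun g :
                (BlockAnderson.stage γ (Finset.Icc a b) u E k).LocalGraph B p.1 q.1 =>
              (BlockAnderson.stage γ (Finset.Icc a b) u E k).wt μ g.1 p.2 q.2) ∧
          -- the Lipschitz bound in operator norm
          ‖Matrix.toEuclideanCLM (𝕜 := ℝ)
              ((BlockAnderson.stage γ (Finset.Icc a b) u E k).Ftilde lam B -
                (BlockAnderson.stage γ (Finset.Icc a b) u E k).Ftilde E B)‖ ≤
            c * (γ / BlockAnderson.eps γ) * |lam - E| := by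
  obtain ⟨γ₀, hγ₀, hsmall⟩ := BlockAnderson.exists_smallCoupling d
  refine ⟨4, γ₀, by norm_num, hγ₀, fun γ hγ hγle a b u hu E lam k hk hlam => ?_⟩
  have h := hsmall γ hγ hγle
  -- Weights of level `n + 1` use resolvents of levels up to `n` only, whose smallest window is
  -- `ε_{n+1}`; hence `ε_k` suffices at level `k`.
  obtain ⟨n, rfl⟩ : ∃ n, k = n + 1 := ⟨k - 1, by omega⟩
  have hB := h.stage_bounded hu hlam
  refine ⟨fun j hj B hBmem hdisj μ hμ => ?_, fun B _ => ⟨fun μ hμ p q => ?_, ?_⟩⟩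
  · obtain ⟨x, hx, rfl⟩ := Finset.mem_image.1 hBmem
    -- A block contains its representative `x`, so disjointness from the next set shows that `x` was
    -- removed.
    have hx' : x ∈ (BlockAnderson.stage γ (Finset.Icc a b) u E j).R \
        (BlockAnderson.stage γ (Finset.Icc a b) u E j).nextR γ E :=
      Finset.mem_sdiff.2 ⟨hx, Finset.disjoint_left.1 hdisj
        (BlockAnderson.Stage.mem_block_self _ hx)⟩
    have hmono := BlockAnderson.epsk_succ_antitone hγ h.le_one (by omega : j ≤ n)
    obtain ⟨h1, h2, -⟩ := (hB j hj.le).mul_norm_le (BlockAnderson.stage_regular γ _ u E j)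
      (BlockAnderson.stage_reversible γ _ u E j) hγ h.le_one h.rpow_le
      (h.factorSum_le _ u E j) (by linarith) hx'
    have hε : 0 < BlockAnderson.epsk γ (j + 1) := by
      rw [BlockAnderson.epsk_succ hγ]; positivity
    rcases hμ with rfl | rfl
    · exact BlockAnderson.isUnit_of_mul_norm_le (by positivity) h2
    · exact BlockAnderson.isUnit_of_mul_norm_le hε h1
  · exact (hB (n + 1) le_rfl).summable (BlockAnderson.stage_regular γ _ u E _) hγ h.le_one
      (h.factorSum_le _ u E _) hμ B p q
  · rw [← BlockAnderson.rpow_eq_div_eps hγ]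
    exact (hB (n + 1) le_rfl).norm_Ftilde_sub_le (BlockAnderson.stage_regular γ _ u E _)
      (BlockAnderson.stage_reversible γ _ u E _) hγ h.le_one (h.factorSum_le _ u E _) B
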